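/- Let $n\ge 1$ be an integer and let $s\in\mathbb R$ satisfy $s-\frac n2\in(0,1)\cup(1,2)$. Let $P_\ell$ be the orthogonal projection of the real space $L^2(\mathbb S^n)$ onto the spherical harmonics of degree $\ell$, and let $H^s(\mathbb S^n)$ be the real Sobolev space with norm $$\|u\|_{H^s}^2=\|u\|_{L^2}^2+\sum_{\ell\ge 0}(\ell(\ell+n-1))^s\|P_\ell u\|_{L^2}^2 .$$ For $u,v\in H^s(\mathbb S^n)$ put $$a_{2s}[u,v]=\sum_{\ell\ge0}\frac{\Gamma(\ell+\frac n2+s)}{\Gamma(\ell+\frac n2-s)}\,(P_\ell u,P_\ell v)_{L^2},\qquad a_{2s}[u]=a_{2s}[u,u].$$ Let $$\mathcal M=\Big\{\omega\mapsto c\,(1-\zeta\cdot\omega)^{\frac{2s-n}{2}}\;:\;c>0,\ \zeta\in\mathbb R^{n+1},\ |\zeta|<1\Big\}\subset H^s(\mathbb S^n),$$ and for $h\in\mathcal M$ let $T_h\mathcal M\subset H^s(\mathbb S^n)$ be the tangent space, i.e. the set of velocities $\gamma'(0)$ of curves $\gamma$ in $\mathcal M$ with $\gamma(0)=h$ that are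 differentiable at $0$ in $H^s(\mathbb S^n)$, and $$(T_h\mathcal M)^\perp=\{\rho\in H^s(\mathbb S^n): a_{2s}[\rho,\varphi]=0\ \text{ for all }\varphi\in T_h\mathcal M\}.$$ For $u\in H^s(\mathbb S^n)$ let $$\mathsf d(u)=\inf\{a_{2s}[\rho]\;:\;u=h+\rho,\ h\in\mathcal M,\ \rho\in(T_h\mathcal M)^\perp\}\in[-\infty,\infty].$$ Then there are neighborhoods $U,V$ of the constant function $1$ in $H^s(\mathbb S^n)$ such that for every $u\in U$ there is a unique $h\in V\cap\mathcal M$ with $u-h\in(T_h\mathcal M)^\perp$. Moreover, for this $h$, $\mathsf d(u)=a_{2s}[u-h]$. -/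

import Mathlib

open MeasureTheory Filter Topology

noncomputable section

namespace ReverseSobolev

/-- The unit sphere `S^n` in `ℝ^(n+1)`. -/
abbrev Sph (n : ℕ) : Type := Metric.sphere (0 : EuclideanSpace ℝ (Fin (n + 1))) 1

/-- The (non-normalized) surface measure on `S^n`. -/
def surf (n : ℕ) : Measure (Sph n) :=
  (volume : Measure (EuclideanSpace ℝ (Fin (n + 1)))).toSphere

instance (n : ℕ) : IsFiniteMeasure (surf n) := by unfold surf; infer_instance

/-- The real Hilbert space `L²(S^n)`. -/
abbrev L2 (n : ℕ) : Type := Lp ℝ 2 (surf n)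

/-- The `i`-th coordinate function on `S^n`. -/
def coord (n : ℕ) (i : Fin (n + 1)) : C(Sph n, ℝ) where
  toFun ω := (ω : EuclideanSpace ℝ (Fin (n + 1))) i
  continuous_toFun := by fun_prop

/-- Restriction of a polynomial on `ℝ^(n+1)` to `S^n`, as an element of `L²(S^n)`. -/
def restrictPoly (n : ℕ) : MvPolynomial (Fin (n + 1)) ℝ →ₗ[ℝ] L2 n :=
  (ContinuousMap.toLp 2 (surf n) ℝ : C(Sph n, ℝ) →L[ℝ] L2 n).toLinearMap ∘ₗ
    (MvPolynomial.aeval (coord n)).toLinearMap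

/-- The Laplacian on polynomials in `n + 1` variables. -/
def polyLaplacian (n : ℕ) :
    MvPolynomial (Fin (n + 1)) ℝ →ₗ[ℝ] MvPolynomial (Fin (n + 1)) ℝ :=
  ∑ i, (MvPolynomial.pderiv i).toLinearMap ∘ₗ (MvPolynomial.pderiv i).toLinearMap

/-- Harmonic homogeneous polynomials of degree `ℓ` in `n + 1` variables. -/
def harmonicPoly (n ℓ : ℕ) : Submodule ℝ (MvPolynomial (Fin (n + 1)) ℝ) :=
  MvPolynomial.homogeneousSubmodule (Fin (n + 1)) ℝ ℓ ⊓ LinearMap.ker (polyLaplacian n)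

/-- The space `E_ℓ ⊆ L²(S^n)` of spherical harmonics of degree `ℓ`. -/
def sphHarm (n ℓ : ℕ) : Submodule ℝ (L2 n) :=
  (harmonicPoly n ℓ).map (restrictPoly n)

instance (n ℓ : ℕ) : FiniteDimensional ℝ (sphHarm n ℓ) := by
  have h1 : FiniteDimensional ℝ (MvPolynomial.homogeneousSubmodule (Fin (n + 1)) ℝ ℓ) :=
    Module.Finite.iff_fg.mpr (MvPolynomial.homogeneousSubmodule_fg _ _ ℓ)
  have h2 : FiniteDimensional ℝ (harmonicPoly n ℓ) :=
    Submodule.finiteDimensional_of_le inf_le_left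
  unfold sphHarm
  infer_instance

/-- `P_ℓ`, the `L²`-orthogonal projection onto spherical harmonics of degree `ℓ`. -/
def proj (n ℓ : ℕ) : L2 n →L[ℝ] L2 n := (sphHarm n ℓ).starProjection

/-- The eigenvalue `ℓ (ℓ + n - 1)` of `-Δ` on spherical harmonics of degree `ℓ`. -/
def lapEig (n ℓ : ℕ) : ℝ := (ℓ : ℝ) * ((ℓ : ℝ) + (n : ℝ) - 1)

lemma lapEig_nonneg (n ℓ : ℕ) : 0 ≤ lapEig n ℓ := by
  unfold lapEig
  rcases Nat.eq_zero_or_pos ℓ with rfl | h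
  · simp
  · have h1 : (1 : ℝ) ≤ ℓ := by exact_mod_cast h
    have h2 : (0 : ℝ) ≤ n := n.cast_nonneg
    exact mul_nonneg (by linarith) (by linarith)

/-- The coefficient sequence of `(-Δ)^(s/2) u`. -/
def fracCoeff (n : ℕ) (s : ℝ) (u : L2 n) (ℓ : ℕ) : L2 n :=
  (lapEig n ℓ ^ (s / 2)) • proj n ℓ u

/-- `H^s(S^n)` as a subspace of `L²(S^n)`: those `u` with `(-Δ)^(s/2) u ∈ L²`. -/
def sobolevSubmodule (n : ℕ) (s : ℝ) : Submodule ℝ (L2 n) where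
  carrier := {u | Memℓp (fracCoeff n s u) 2}
  zero_mem' := by
    have : fracCoeff n s 0 = 0 := by ext1 ℓ; simp [fracCoeff]
    simp only [Set.mem_ofPred_eq, this]
    exact zero_memℓp
  add_mem' {u v} hu hv := by
    have : fracCoeff n s (u + v) = fracCoeff n s u + fracCoeff n s v := by
      ext1 ℓ; simp [fracCoeff]
    simp only [Set.mem_ofPred_eq, this]
    exact hu.add hv
  smul_mem' c u hu := by
    have : fracCoeff n s (c • u) = c • fracCoeff n s u := by
      ext1 ℓ; simp [fracCoeff, smul_comm c]
    simp only [Set.mem_ofPred_eq, this]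
    exact hu.const_smul c

/-- The Sobolev space `H^s(S^n)`; a type of its own, since its norm is not that of `L²`. -/
def Sob (n : ℕ) (s : ℝ) : Type := sobolevSubmodule n s

instance (n : ℕ) (s : ℝ) : AddCommGroup (Sob n s) :=
  inferInstanceAs (AddCommGroup (sobolevSubmodule n s))

instance (n : ℕ) (s : ℝ) : Module ℝ (Sob n s) :=
  inferInstanceAs (Module ℝ (sobolevSubmodule n s))

/-- The inclusion `H^s(S^n) → L²(S^n)`. -/
def Sob.toL2 {n : ℕ} {s : ℝ} : Sob n s →ₗ[ℝ] L2 n := (sobolevSubmodule n s).subtype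

/-- `(-Δ)^(s/2)` on `H^s(S^n)`, as the square summable sequence of its components. -/
def Sob.frac {n : ℕ} {s : ℝ} : Sob n s →ₗ[ℝ] lp (fun _ : ℕ => L2 n) 2 where
  toFun u := ⟨fracCoeff n s u.toL2, u.2⟩
  map_add' u v := by
    refine Subtype.ext (funext fun ℓ => ?_)
    change fracCoeff n s (u + v).toL2 ℓ = fracCoeff n s u.toL2 ℓ + fracCoeff n s v.toL2 ℓ
    simp [fracCoeff]
  map_smul' c u := by
    refine Subtype.ext (funext fun ℓ => ?_)
    change fracCoeff n s (c • u).toL2 ℓ = c • fracCoeff n s u.toL2 ℓ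
    simp [fracCoeff, smul_comm c]

/-- `u ↦ (u, (-Δ)^(s/2) u)`, whose graph norm is the `H^s` norm. -/
def Sob.graph {n : ℕ} {s : ℝ} :
    Sob n s →ₗ[ℝ] WithLp 2 (L2 n × lp (fun _ : ℕ => L2 n) 2) :=
  (WithLp.linearEquiv 2 ℝ (L2 n × lp (fun _ : ℕ => L2 n) 2)).symm.toLinearMap ∘ₗ
    (Sob.toL2.prod Sob.frac)

lemma Sob.graph_injective {n : ℕ} {s : ℝ} : Function.Injective (Sob.graph (n := n) (s := s)) := by
  intro u v h
  have h' : Sob.toL2 u = Sob.toL2 v := congrArg (fun x => x.fst) h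
  exact Subtype.ext h'

instance (n : ℕ) (s : ℝ) : NormedAddCommGroup (Sob n s) :=
  NormedAddCommGroup.induced (Sob n s) _ Sob.graph Sob.graph_injective

instance (n : ℕ) (s : ℝ) : NormedSpace ℝ (Sob n s) :=
  NormedSpace.induced ℝ (Sob n s) _ Sob.graph

/-- The norm of `H^s`: `‖u‖² = ‖u‖²_{L²} + ∑_ℓ (ℓ(ℓ+n-1))^s ‖P_ℓ u‖²_{L²}`. -/
lemma Sob.norm_sq_eq {n : ℕ} {s : ℝ} (u : Sob n s) :
    ‖u‖ ^ 2 = ‖u.toL2‖ ^ 2 + ∑' ℓ, lapEig n ℓ ^ s * ‖proj n ℓ u.toL2‖ ^ 2 := by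
  have h0 : ‖u‖ = ‖Sob.graph u‖ := rfl
  have h1 : ‖Sob.graph u‖ ^ 2 = ‖u.toL2‖ ^ 2 + ‖Sob.frac u‖ ^ 2 :=
    WithLp.prod_norm_sq_eq_of_L2 _
  have h2 := lp.norm_rpow_eq_tsum (p := 2) (by norm_num) (Sob.frac u)
  simp only [ENNReal.toReal_ofNat, Real.rpow_two] at h2
  rw [h0, h1, h2]
  congr 1
  refine tsum_congr fun ℓ => ?_
  change ‖(lapEig n ℓ ^ (s / 2)) • proj n ℓ u.toL2‖ ^ 2 = _
  rw [norm_smul, mul_pow, Real.norm_eq_abs, sq_abs, ← Real.rpow_two,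
    ← Real.rpow_mul (lapEig_nonneg n ℓ)]
  norm_num

/-- `α_{2s}(ℓ) = Γ(ℓ + n/2 + s) / Γ(ℓ + n/2 - s)`. -/
def alpha (n : ℕ) (s : ℝ) (ℓ : ℕ) : ℝ :=
  Real.Gamma (ℓ + n / 2 + s) / Real.Gamma (ℓ + n / 2 - s)

/-- The bilinear form `a_{2s}[u, v] = ∑_ℓ α_{2s}(ℓ) (P_ℓ u, P_ℓ v)` on `H^s(S^n)`. -/
def aForm {n : ℕ} {s : ℝ} (u v : Sob n s) : ℝ :=
  ∑' ℓ, alpha n s ℓ * inner ℝ (proj n ℓ u.toL2) (proj n ℓ v.toL2)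

/-- The quadratic form `a_{2s}[u] = ∑_ℓ α_{2s}(ℓ) ‖P_ℓ u‖²` on `H^s(S^n)`. -/
def aQuad {n : ℕ} {s : ℝ} (u : Sob n s) : ℝ :=
  ∑' ℓ, alpha n s ℓ * ‖proj n ℓ u.toL2‖ ^ 2

/-- The functions `ω ↦ c (1 - ζ·ω)^((2s-n)/2)` with `c > 0`, `|ζ| < 1`, in `H^s(S^n)`. -/
def optimizers (n : ℕ) (s : ℝ) : Set (Sob n s) :=
  {h | ∃ c : ℝ, 0 < c ∧ ∃ ζ : EuclideanSpace ℝ (Fin (n + 1)), ‖ζ‖ < 1 ∧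
    ∀ᵐ ω ∂(surf n), h.toL2 ω =
      c * (1 - inner ℝ ζ (ω : EuclideanSpace ℝ (Fin (n + 1)))) ^ ((2 * s - n) / 2)}

/-- The tangent space at `h` of the manifold of optimizers: the velocities at time `0` of
curves in the manifold through `h`, differentiable at `0` as curves in `H^s(S^n)`. -/
def tangent {n : ℕ} {s : ℝ} (h : Sob n s) : Set (Sob n s) :=
  {η | ∃ γ : ℝ → Sob n s, (∀ᶠ t in 𝓝 0, γ t ∈ optimizers n s) ∧ γ 0 = h ∧ HasDerivAt γ η 0}

/-- The orthogonal complement of the tangent space at `h` with respect to `a_{2s}`. -/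
def tangentPerp {n : ℕ} {s : ℝ} (h : Sob n s) : Set (Sob n s) :=
  {ρ | ∀ φ ∈ tangent h, aForm ρ φ = 0}

/-- The modified distance of `u` to the optimizers, an infimum in `[-∞, ∞]`. -/
def modDist {n : ℕ} {s : ℝ} (u : Sob n s) : EReal :=
  sInf {x | ∃ h ∈ optimizers n s, ∃ ρ ∈ tangentPerp h, u = h + ρ ∧ x = ((aQuad ρ : ℝ) : EReal)}

end ReverseSobolev

end

open ReverseSobolev

/-!
For `e` of norm one, the first-order operator `L_e` generating the conformal dilations of the sphere
in direction `e` is skew for `a_{2s}`: it maps the spherical harmonics of degree `ℓ` into those of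
degrees `ℓ ± 1`, and `alpha (ℓ + 1) / alpha ℓ` is exactly the ratio that makes the form invariant.

Write `b_ζ = (1 - ζ · ω) ^ (s - n / 2)`. Since `alpha 0` and `alpha 1` are nonzero, the form is
nondegenerate on the tangent space at `1`, which is spanned by `1` and the linear functions; hence
the implicit function theorem gives exactly one orthogonal decomposition `u = h + ρ` with parameters
`(c, ζ)` of `h = c b_ζ` near `(1, 0)`.

It remains to see that every orthogonal decomposition of a `u` near `1` has parameters near
`(1, 0)`. Since `L_e b_ζ`, `e = ζ / |ζ|`, is tangent at `h` and `a_{2s}`-orthogonal to `b_ζ` by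
skewness, `a_{2s}[u, L_e b_ζ] = 0`, so `a_{2s}[1, L_e b_ζ] = -a_{2s}[u - 1, L_e b_ζ]`. The left side
is a multiple of the moment of `b_ζ` in direction `e`, which is small only for small `ζ`; the right
side is `O(‖u - 1‖)` because `L_e b_ζ` stays bounded in `H^s` as `|ζ| → 1`: by skewness again,
`N(r) = a_{2s}[L_e b_{re}]` satisfies `N' = -2 r (s - n / 2) / (1 - r ^ 2) N`, and `a_{2s}` controls
the `H^s` norm up to a multiple of the `L^2` norm.
-/

noncomputable section

namespace ReverseSobolev

/-! ### Orthogonality of spherical harmonics -/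

section Gaussian

open MvPolynomial

variable {ι : Type*}

lemma hasLineDerivAt_eval [DecidableEq ι] (p : MvPolynomial ι ℝ) (x : EuclideanSpace ℝ ι) (i : ι) :
    HasLineDerivAt ℝ (fun y : EuclideanSpace ℝ ι => eval y.ofLp p) (eval x.ofLp (pderiv i p)) x
      (EuclideanSpace.single i 1) := by
  unfold HasLineDerivAt
  induction p using MvPolynomial.induction_on with
  | C a => simpa using hasDerivAt_const (0 : ℝ) a
  | add p q hp hq => simpa using hp.fun_add hq
  | mul_X p j hp =>
    have hX : HasDerivAt (fun t : ℝ => (x + t • EuclideanSpace.single i (1 : ℝ)) j)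
        (1 * EuclideanSpace.single i (1 : ℝ) j) 0 :=
      ((hasDerivAt_id (0 : ℝ)).mul_const _).const_add (x j)
    simp only [map_mul, eval_X]
    refine (hp.fun_mul hX).congr_deriv ?_
    obtain rfl | hij := eq_or_ne i j
    · simp; ring
    · simp [pderiv_X_of_ne hij.symm, hij.symm]; ring

variable [Fintype ι]

lemma hasLineDerivAt_exp_neg_half_sq_norm [DecidableEq ι] (x : EuclideanSpace ℝ ι) (i : ι) :
    HasLineDerivAt ℝ (fun y : EuclideanSpace ℝ ι => Real.exp (-(1 / 2) * ‖y‖ ^ 2))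
      (-(x i) * Real.exp (-(1 / 2) * ‖x‖ ^ 2)) x (EuclideanSpace.single i 1) := by
  have hsq := (hasStrictFDerivAt_norm_sq x).hasFDerivAt.const_mul (-(1 / 2) : ℝ)
  have hx : inner ℝ x (EuclideanSpace.single i (1 : ℝ)) = x i := by
    rw [real_inner_comm, EuclideanSpace.inner_single_left]; simp
  refine (HasFDerivAt.hasLineDerivAt hsq.exp (EuclideanSpace.single i 1)).congr_deriv ?_
  simp [hx, mul_comm]

lemma le_mul_exp_mul_sq {b : ℝ} (hb : 0 < b) (t : ℝ) :
    t ≤ (1 + 1 / b) * Real.exp (b * t ^ 2) :=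
  calc t ≤ 1 + 1 / b * (b * t ^ 2) := by field_simp; nlinarith [sq_nonneg (t - 1)]
    _ ≤ Real.exp (b * t ^ 2) + 1 / b * Real.exp (b * t ^ 2) := by
      have := Real.add_one_le_exp (b * t ^ 2)
      gcongr
      · exact Real.one_le_exp (by positivity)
      · linarith
    _ = (1 + 1 / b) * Real.exp (b * t ^ 2) := by ring

lemma integrable_exp_neg_mul_sq_norm {b : ℝ} (hb : 0 < b) :
    Integrable (fun x : EuclideanSpace ℝ ι => Real.exp (-b * ‖x‖ ^ 2)) := by
  convert (GaussianFourier.integrable_cexp_neg_mul_sq_norm_add (V := EuclideanSpace ℝ ι) (b := b)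
    (by simpa using hb) 0 0).re using 2 with x
  simp [← Complex.ofReal_pow, ← Complex.ofReal_mul, ← Complex.ofReal_neg, ← Complex.ofReal_exp]

-- Half of the Gaussian absorbs `g`, so the exponent `b` has to vary in an induction on the degree.
lemma integrable_mul_exp_of_abs_le_norm {f g : EuclideanSpace ℝ ι → ℝ} (hg : Continuous g)
    (hg_le : ∀ x, |g x| ≤ ‖x‖)
    (hf : ∀ b > 0, Integrable (fun x => f x * Real.exp (-b * ‖x‖ ^ 2))) {b : ℝ} (hb : 0 < b) :
    Integrable (fun x => f x * g x * Real.exp (-b * ‖x‖ ^ 2)) := by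
  have hb2 : 0 < b / 2 := half_pos hb
  have hbound : ∀ x, ‖g x * Real.exp (-(b / 2) * ‖x‖ ^ 2)‖ ≤ 1 + 1 / (b / 2) := fun x => by
    rw [norm_mul, Real.norm_eq_abs, Real.norm_eq_abs, Real.abs_exp, neg_mul, Real.exp_neg,
      ← div_eq_mul_inv, div_le_iff₀ (Real.exp_pos _)]
    exact (hg_le x).trans (le_mul_exp_mul_sq hb2 ‖x‖)
  refine ((hf _ hb2).mul_bdd (by fun_prop) (Eventually.of_forall hbound)).congr
    (Eventually.of_forall fun x => ?_)
  have hexp : Real.exp (-b * ‖x‖ ^ 2) =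
      Real.exp (-(b / 2) * ‖x‖ ^ 2) * Real.exp (-(b / 2) * ‖x‖ ^ 2) := by
    rw [← Real.exp_add]; ring_nf
  simp only [hexp]
  ring

lemma integrable_eval_mul_exp (p : MvPolynomial ι ℝ) {b : ℝ} (hb : 0 < b) :
    Integrable (fun x : EuclideanSpace ℝ ι => eval x.ofLp p * Real.exp (-b * ‖x‖ ^ 2)) := by
  induction p using MvPolynomial.induction_on generalizing b with
  | C a => simpa using (integrable_exp_neg_mul_sq_norm hb).const_mul a
  | add p q hp hq => simpa [add_mul] using (hp hb).fun_add (hq hb)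
  | mul_X p j hp =>
    simpa using integrable_mul_exp_of_abs_le_norm (g := fun x : EuclideanSpace ℝ ι => x j)
      (by fun_prop) (fun x => by simpa using PiLp.norm_apply_le x j) (fun _ => hp) hb

lemma integrable_norm_pow_mul_exp (d : ℕ) {b : ℝ} (hb : 0 < b) :
    Integrable (fun x : EuclideanSpace ℝ ι => ‖x‖ ^ d * Real.exp (-b * ‖x‖ ^ 2)) := by
  induction d generalizing b with
  | zero => simpa using integrable_exp_neg_mul_sq_norm hb
  | succ d hd =>
    simpa [pow_succ] using integrable_mul_exp_of_abs_le_norm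
      (g := fun x : EuclideanSpace ℝ ι => ‖x‖) (by fun_prop) (fun x => by simp) (fun _ => hd) hb

/-- The integral of a polynomial against the (non-normalized) standard Gaussian. -/
def gaussianIntegral (ι : Type*) [Fintype ι] : MvPolynomial ι ℝ →ₗ[ℝ] ℝ where
  toFun p := ∫ x : EuclideanSpace ℝ ι, eval x.ofLp p * Real.exp (-(1 / 2) * ‖x‖ ^ 2)
  map_add' p q := by
    simp only [map_add, add_mul]
    exact integral_add (integrable_eval_mul_exp p one_half_pos)
      (integrable_eval_mul_exp q one_half_pos)
  map_smul' c p := by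
    simp only [smul_eval, mul_assoc, integral_const_mul, RingHom.id_apply, smul_eq_mul]

lemma gaussianIntegral_apply (p : MvPolynomial ι ℝ) : gaussianIntegral ι p =
    ∫ x : EuclideanSpace ℝ ι, eval x.ofLp p * Real.exp (-(1 / 2) * ‖x‖ ^ 2) := rfl

lemma gaussianIntegral_pderiv (p : MvPolynomial ι ℝ) (i : ι) :
    gaussianIntegral ι (pderiv i p) = gaussianIntegral ι (X i * p) := by
  classical
  have h := integral_bilinear_hasLineDerivAt_right_eq_neg_left_of_integrable
    (μ := (volume : Measure (EuclideanSpace ℝ ι))) (v := EuclideanSpace.single i (1 : ℝ))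
    (B := ContinuousLinearMap.mul ℝ ℝ)
    (g := fun x : EuclideanSpace ℝ ι => Real.exp (-(1 / 2) * ‖x‖ ^ 2))
    (g' := fun x : EuclideanSpace ℝ ι => -(x i) * Real.exp (-(1 / 2) * ‖x‖ ^ 2))
    (integrable_eval_mul_exp (pderiv i p) one_half_pos)
    ((integrable_eval_mul_exp (-(p * X i)) one_half_pos).congr
      (Eventually.of_forall fun x => by simp [mul_assoc]))
    (integrable_eval_mul_exp p one_half_pos)
    (fun x _ => hasLineDerivAt_eval p x i) (fun x _ => hasLineDerivAt_exp_neg_half_sq_norm x i)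
  simp only [ContinuousLinearMap.mul_apply'] at h
  rw [gaussianIntegral_apply, ← neg_eq_iff_eq_neg.mpr h, ← integral_neg, gaussianIntegral_apply]
  refine integral_congr_ae (Eventually.of_forall fun x => ?_)
  simp only [map_mul, eval_X]
  ring

end Gaussian

section Polar

open Measure

lemma integral_homogeneous_mul_radial {E : Type*} [NormedAddCommGroup E] [NormedSpace ℝ E]
    [FiniteDimensional ℝ E] [Nontrivial E] [MeasurableSpace E] [BorelSpace E] (μ : Measure E)
    [μ.IsAddHaarMeasure] {f : E → ℝ} {d : ℕ} (g : ℝ → ℝ)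
    (hf : ∀ (r : ℝ) (x : E), 0 < r → f (r • x) = r ^ d * f x) :
    ∫ x, f x * g ‖x‖ ∂μ = (∫ ω : Metric.sphere (0 : E) 1, f ω ∂μ.toSphere) *
      ∫ r : Set.Ioi (0 : ℝ), (r : ℝ) ^ d * g r ∂(.volumeIoiPow (Module.finrank ℝ E - 1)) := by
  calc
    ∫ x, f x * g ‖x‖ ∂μ
      = ∫ x : ({(0 : E)}ᶜ : Set E), f x.1 * g ‖x.1‖ ∂(μ.comap Subtype.val) := by
      rw [integral_subtype_comap (measurableSet_singleton _).compl fun x : E => f x * g ‖x‖,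
        restrict_compl_singleton]
    _ = ∫ y : Metric.sphere (0 : E) 1 × Set.Ioi (0 : ℝ), f (y.1 : E) * ((y.2 : ℝ) ^ d * g y.2)
        ∂(μ.toSphere.prod (.volumeIoiPow (Module.finrank ℝ E - 1))) := by
      rw [← μ.measurePreserving_homeomorphUnitSphereProd.integral_comp
        (Homeomorph.measurableEmbedding _)]
      refine integral_congr_ae (Eventually.of_forall fun x => ?_)
      have hx : 0 < ‖(x : E)‖ := norm_pos_iff.mpr x.2
      have hfx : f x = ‖(x : E)‖ ^ d * f (‖(x : E)‖⁻¹ • (x : E)) := by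
        rw [← hf _ _ hx, smul_smul, mul_inv_cancel₀ hx.ne', one_smul]
      simp only [homeomorphUnitSphereProd_apply_snd_coe, homeomorphUnitSphereProd_apply_fst_coe]
      rw [hfx]; ring
    _ = _ := integral_prod_mul (fun ω : Metric.sphere (0 : E) 1 => f ω)
        (fun r : Set.Ioi (0 : ℝ) => (r : ℝ) ^ d * g r)

lemma eval_smul_of_isHomogeneous {ι R : Type*} [CommSemiring R] {p : MvPolynomial ι R} {d : ℕ}
    (hp : p.IsHomogeneous d) (r : R) (x : ι → R) :
    MvPolynomial.eval (r • x) p = r ^ d * MvPolynomial.eval x p := by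
  simp only [MvPolynomial.eval_eq, Finset.mul_sum]
  refine Finset.sum_congr rfl fun e he => ?_
  have hd : ∑ i ∈ e.support, e i = d := by
    rw [← hp (MvPolynomial.mem_support_iff.mp he), Finsupp.weight_apply, Finsupp.sum]
    simp
  simp only [Pi.smul_apply, smul_eq_mul, mul_pow, Finset.prod_mul_distrib,
    Finset.prod_pow_eq_pow_sum, hd]
  ring

variable {ι : Type*} [Fintype ι]

lemma integral_norm_pow_mul_exp_pos [Nonempty ι] (d : ℕ) :
    0 < ∫ x : EuclideanSpace ℝ ι, ‖x‖ ^ d * Real.exp (-(1 / 2) * ‖x‖ ^ 2) := by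
  classical
  inhabit ι
  refine integral_pos_of_integrable_nonneg_nonzero (x := EuclideanSpace.single default 1)
    (by fun_prop) (integrable_norm_pow_mul_exp d one_half_pos) (fun x => by positivity) ?_
  simp

-- In polar coordinates the Gaussian integral of `p` is that over the sphere times a radial moment,
-- which is nonzero because it also occurs in the integral of `‖x‖ ^ d`.
lemma integral_sphere_eq_zero_of_gaussianIntegral [Nonempty ι] {p : MvPolynomial ι ℝ} {d : ℕ}
    (hp : p.IsHomogeneous d) (h : gaussianIntegral ι p = 0) :
    ∫ ω : Metric.sphere (0 : EuclideanSpace ℝ ι) 1, MvPolynomial.eval ω.1.ofLp p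
      ∂(volume : Measure (EuclideanSpace ℝ ι)).toSphere = 0 := by
  have hpos := integral_norm_pow_mul_exp_pos (ι := ι) d
  rw [integral_homogeneous_mul_radial volume (fun r => Real.exp (-(1 / 2) * r ^ 2))
    (fun r x hr => by rw [norm_smul, Real.norm_of_nonneg hr.le, mul_pow])] at hpos
  rw [gaussianIntegral_apply,
    integral_homogeneous_mul_radial volume (fun r => Real.exp (-(1 / 2) * r ^ 2))
      (fun r x _ => eval_smul_of_isHomogeneous hp r x.ofLp)] at h
  exact (mul_eq_zero.mp h).resolve_right (right_ne_zero_of_mul hpos.ne')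

end Polar

section Orthogonality

open MvPolynomial

variable {n : ℕ}

lemma polyLaplacian_apply (p : MvPolynomial (Fin (n + 1)) ℝ) :
    polyLaplacian n p = ∑ i, pderiv i (pderiv i p) := by
  simp [polyLaplacian]

lemma sum_pderiv_wronskian (p q : MvPolynomial (Fin (n + 1)) ℝ) :
    ∑ i, pderiv i (pderiv i p * q - p * pderiv i q) =
      polyLaplacian n p * q - p * polyLaplacian n q := by
  simp only [polyLaplacian_apply, Finset.sum_mul, Finset.mul_sum, ← Finset.sum_sub_distrib]
  refine Finset.sum_congr rfl fun i _ => ?_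
  simp only [map_sub, Derivation.leibniz, smul_eq_mul]
  ring

lemma sum_X_mul_wronskian {ι : Type*} [Fintype ι] {p q : MvPolynomial ι ℝ} {k m : ℕ}
    (hp : p.IsHomogeneous k) (hq : q.IsHomogeneous m) :
    ∑ i, X i * (pderiv i p * q - p * pderiv i q) = ((k : ℝ) - m) • (p * q) := by
  calc ∑ i, X i * (pderiv i p * q - p * pderiv i q)
      = (∑ i, X i * pderiv i p) * q - p * ∑ i, X i * pderiv i q := by
        simp only [Finset.sum_mul, Finset.mul_sum, ← Finset.sum_sub_distrib]
        exact Finset.sum_congr rfl fun i _ => by ring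
    _ = ((k : ℝ) - m) • (p * q) := by
        rw [hp.sum_X_mul_pderiv, hq.sum_X_mul_pderiv, smul_mul_assoc, mul_smul_comm, sub_smul,
          Nat.cast_smul_eq_nsmul, Nat.cast_smul_eq_nsmul]

-- The Gaussian integrals of the two Wronskian sums agree by parts; the first one vanishes.
lemma integral_mul_harmonicPoly_eq_zero {k m : ℕ} (hkm : k ≠ m)
    {p q : MvPolynomial (Fin (n + 1)) ℝ} (hp : p ∈ harmonicPoly n k) (hq : q ∈ harmonicPoly n m) :
    ∫ ω : Sph n, eval ω.1.ofLp (p * q) ∂(surf n) = 0 := by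
  refine integral_sphere_eq_zero_of_gaussianIntegral (hp.1.mul hq.1) ?_
  have hpΔ : polyLaplacian n p = 0 := hp.2
  have hqΔ : polyLaplacian n q = 0 := hq.2
  have hparts : ((k : ℝ) - m) • gaussianIntegral (Fin (n + 1)) (p * q) = 0 :=
    calc ((k : ℝ) - m) • gaussianIntegral (Fin (n + 1)) (p * q)
        = gaussianIntegral _ (∑ i, X i * (pderiv i p * q - p * pderiv i q)) := by
          rw [sum_X_mul_wronskian hp.1 hq.1, map_smul]
      _ = gaussianIntegral _ (∑ i, pderiv i (pderiv i p * q - p * pderiv i q)) := by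
          simp only [map_sum, gaussianIntegral_pderiv]
      _ = 0 := by rw [sum_pderiv_wronskian, hpΔ, hqΔ, zero_mul, mul_zero, sub_zero, map_zero]
  exact (smul_eq_zero.mp hparts).resolve_left (sub_ne_zero.mpr (Nat.cast_injective.ne hkm))

end Orthogonality

/-! ### Multiplication of harmonic polynomials by linear forms -/

section HarmonicPolynomials

open MvPolynomial

variable {n : ℕ}

/-- The ambient Euclidean space `ℝ^(n+1)`. -/
abbrev Amb (n : ℕ) : Type := EuclideanSpace ℝ (Fin (n + 1))

/-- Polynomial functions on `ℝ^(n+1)`. -/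
abbrev Poly (n : ℕ) : Type := MvPolynomial (Fin (n + 1)) ℝ

/-- The linear form `x ↦ ζ · x`, as a polynomial. -/
def linForm (n : ℕ) : Amb n →ₗ[ℝ] Poly n where
  toFun ζ := ∑ i, ζ i • X i
  map_add' ζ η := by simp [add_smul, Finset.sum_add_distrib]
  map_smul' c ζ := by simp [mul_smul, Finset.smul_sum]

/-- The derivation `ζ · ∇` on polynomials. -/
def dirDeriv (ζ : Amb n) : Derivation ℝ (Poly n)
    (Poly n) :=
  ∑ i, ζ i • pderiv i

/-- The Euler derivation `x · ∇` on polynomials. -/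
def eulerDeriv (n : ℕ) : Derivation ℝ (Poly n)
    (Poly n) :=
  ∑ i, (X i : Poly n) • pderiv i

/-- The polynomial `|x|²`. -/
def normSqPoly (n : ℕ) : Poly n := ∑ i, X i ^ 2

lemma linForm_apply (ζ : Amb n) : linForm n ζ = ∑ i, ζ i • X i := rfl

lemma dirDeriv_apply (ζ : Amb n) (p : Poly n) :
    dirDeriv ζ p = ∑ i, ζ i • pderiv i p := by
  change Derivation.coeFnAddMonoidHom (∑ i, ζ i • pderiv i) p = _
  rw [map_sum, Finset.sum_apply]
  rfl

lemma eulerDeriv_apply (p : Poly n) :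
    eulerDeriv n p = ∑ i, X i * pderiv i p := by
  change Derivation.coeFnAddMonoidHom
    (∑ i, (X i : Poly n) • pderiv i) p = _
  rw [map_sum, Finset.sum_apply]
  rfl

lemma eulerDeriv_of_isHomogeneous {p : Poly n} {k : ℕ}
    (hp : p.IsHomogeneous k) : eulerDeriv n p = (k : ℝ) • p := by
  rw [eulerDeriv_apply, hp.sum_X_mul_pderiv, Nat.cast_smul_eq_nsmul]

lemma pderiv_linForm (ζ : Amb n) (i : Fin (n + 1)) : pderiv i (linForm n ζ) = C (ζ i) := by
  simp [linForm_apply, pderiv_X, Pi.single_apply, smul_eq_C_mul]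

lemma dirDeriv_linForm (ζ η : Amb n) : dirDeriv ζ (linForm n η) = C (inner ℝ ζ η) := by
  simp [dirDeriv_apply, pderiv_linForm, PiLp.inner_apply, smul_eq_C_mul, mul_comm]

lemma eulerDeriv_linForm (ζ : Amb n) : eulerDeriv n (linForm n ζ) = linForm n ζ := by
  simp only [eulerDeriv_apply, pderiv_linForm]
  simp [linForm_apply, smul_eq_C_mul, mul_comm]

lemma pderiv_normSqPoly (i : Fin (n + 1)) : pderiv i (normSqPoly n) = 2 * X i := by
  simp [normSqPoly, pderiv_X, Pi.single_apply, Derivation.leibniz_pow, mul_ite]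

lemma dirDeriv_normSqPoly (ζ : Amb n) : dirDeriv ζ (normSqPoly n) = 2 * linForm n ζ := by
  simp [dirDeriv_apply, pderiv_normSqPoly, linForm_apply, Finset.mul_sum]

lemma eulerDeriv_normSqPoly : eulerDeriv n (normSqPoly n) = 2 * normSqPoly n := by
  simp only [eulerDeriv_apply, pderiv_normSqPoly]
  rw [normSqPoly, Finset.mul_sum]
  exact Finset.sum_congr rfl fun i _ => by ring

lemma polyLaplacian_linForm_mul (ζ : Amb n) (p : Poly n) :
    polyLaplacian n (linForm n ζ * p) =
      2 * dirDeriv ζ p + linForm n ζ * polyLaplacian n p := by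
  simp only [polyLaplacian_apply, dirDeriv_apply, Finset.mul_sum, ← Finset.sum_add_distrib]
  refine Finset.sum_congr rfl fun i _ => ?_
  simp only [Derivation.leibniz, pderiv_linForm, smul_eq_mul, map_add, pderiv_C, smul_eq_C_mul]
  ring

lemma polyLaplacian_normSqPoly_mul (p : Poly n) :
    polyLaplacian n (normSqPoly n * p) =
      (2 * ((n : ℝ) + 1)) • p + 4 * eulerDeriv n p + normSqPoly n * polyLaplacian n p := by
  have h1 : (2 * ((n : ℝ) + 1)) • p = ∑ _i : Fin (n + 1), 2 * p := by
    simp [smul_eq_C_mul, map_ofNat C 2]; ring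
  simp only [polyLaplacian_apply, eulerDeriv_apply, Finset.mul_sum, h1, ← Finset.sum_add_distrib]
  refine Finset.sum_congr rfl fun i _ => ?_
  have h2 : pderiv i (2 : Poly n) = 0 := by
    rw [← map_ofNat C 2, pderiv_C]
  simp only [Derivation.leibniz, pderiv_normSqPoly, smul_eq_mul, map_add, h2, pderiv_X_self]
  ring

lemma isHomogeneous_linForm (ζ : Amb n) : (linForm n ζ).IsHomogeneous 1 := by
  rw [linForm_apply]
  refine IsHomogeneous.sum _ _ _ fun i _ => ?_
  simpa [smul_eq_C_mul] using (isHomogeneous_C _ (ζ i)).mul (isHomogeneous_X ℝ i)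

lemma isHomogeneous_normSqPoly : (normSqPoly n).IsHomogeneous 2 :=
  IsHomogeneous.sum _ _ _ fun i _ => by simpa using (isHomogeneous_X ℝ i).pow 2

lemma isHomogeneous_dirDeriv (ζ : Amb n) {p : Poly n} {k : ℕ}
    (hp : p.IsHomogeneous k) : (dirDeriv ζ p).IsHomogeneous (k - 1) := by
  rw [dirDeriv_apply]
  refine IsHomogeneous.sum _ _ _ fun i _ => ?_
  simpa [smul_eq_C_mul] using (isHomogeneous_C _ (ζ i)).mul (hp.pderiv (i := i))

lemma pderiv_comm {ι R : Type*} [CommRing R] (i j : ι) (p : MvPolynomial ι R) :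
    pderiv i (pderiv j p) = pderiv j (pderiv i p) := by
  classical
  have h : ⁅pderiv (R := R) i, pderiv (R := R) j⁆ = 0 :=
    derivation_ext fun k => by
      simp [Derivation.commutator_apply, pderiv_X, Pi.single_apply, apply_ite]
  simpa [Derivation.commutator_apply, sub_eq_zero] using DFunLike.congr_fun h p

lemma polyLaplacian_dirDeriv (ζ : Amb n) (p : Poly n) :
    polyLaplacian n (dirDeriv ζ p) = dirDeriv ζ (polyLaplacian n p) := by
  simp only [polyLaplacian_apply, map_sum]
  refine Finset.sum_congr rfl fun i _ => ?_
  simp only [dirDeriv_apply, map_sum, Derivation.map_smul]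
  exact Finset.sum_congr rfl fun j _ => by rw [pderiv_comm i j, pderiv_comm i j]

/-- The component of `(ζ · x) p` of degree `ℓ - 1`, for a harmonic `p` of degree `ℓ`. -/
def lower (ζ : Amb n) (ℓ : ℕ) (p : Poly n) :
    Poly n :=
  (2 * (ℓ : ℝ) + n - 1)⁻¹ • dirDeriv ζ p

/-- The component of `(ζ · x) p` of degree `ℓ + 1`, for a harmonic `p` of degree `ℓ`. -/
def raise (ζ : Amb n) (ℓ : ℕ) (p : Poly n) :
    Poly n :=
  linForm n ζ * p - normSqPoly n * lower ζ ℓ p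

lemma dirDeriv_eq_zero_of_isHomogeneous_zero (ζ : Amb n) {p : Poly n} (hp : p.IsHomogeneous 0) :
    dirDeriv ζ p = 0 := by
  rw [totalDegree_eq_zero_iff_eq_C.mp (Nat.le_zero.mp hp.totalDegree_le), dirDeriv_apply]
  simp

lemma lower_eq_zero_of_mem_zero (ζ : Amb n) (k : ℕ) {p : Poly n} (hp : p ∈ harmonicPoly n 0) :
    lower ζ k p = 0 := by
  rw [lower, dirDeriv_eq_zero_of_isHomogeneous_zero ζ hp.1, smul_zero]

lemma isHomogeneous_lower (ζ : Amb n) {ℓ : ℕ} {p : Poly n} (hp : p.IsHomogeneous ℓ) (k : ℕ) :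
    (lower ζ k p).IsHomogeneous (ℓ - 1) :=
  Submodule.smul_mem (homogeneousSubmodule _ _ _) _ (isHomogeneous_dirDeriv ζ hp)

lemma polyLaplacian_lower (ζ : Amb n) (k : ℕ) {p : Poly n} (hp : polyLaplacian n p = 0) :
    polyLaplacian n (lower ζ k p) = 0 := by
  rw [lower, map_smul, polyLaplacian_dirDeriv, hp, map_zero, smul_zero]

lemma lower_mem (ζ : Amb n) {ℓ : ℕ} {p : Poly n}
    (hp : p ∈ harmonicPoly n (ℓ + 1)) : lower ζ (ℓ + 1) p ∈ harmonicPoly n ℓ :=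
  ⟨isHomogeneous_lower ζ hp.1 _, polyLaplacian_lower ζ _ hp.2⟩

lemma smul_lower (ζ : Amb n) {ℓ : ℕ} {p : Poly n} (hp : p ∈ harmonicPoly n ℓ) :
    (2 * (ℓ : ℝ) + n - 1) • lower ζ ℓ p = dirDeriv ζ p := by
  rcases ℓ with _ | ℓ
  · rw [lower_eq_zero_of_mem_zero ζ _ hp, dirDeriv_eq_zero_of_isHomogeneous_zero ζ hp.1, smul_zero]
  · have hℓ : (0 : ℝ) < 2 * ((ℓ + 1 : ℕ) : ℝ) + n - 1 := by
      push_cast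
      linarith [(Nat.cast_nonneg ℓ : (0 : ℝ) ≤ ℓ), (Nat.cast_nonneg n : (0 : ℝ) ≤ n)]
    rw [lower, smul_smul, mul_inv_cancel₀ hℓ.ne', one_smul]

lemma isHomogeneous_raise (ζ : Amb n) {ℓ : ℕ} {p : Poly n} (hp : p ∈ harmonicPoly n ℓ) :
    (raise ζ ℓ p).IsHomogeneous (ℓ + 1) := by
  have hlow : (normSqPoly n * lower ζ ℓ p).IsHomogeneous (ℓ + 1) := by
    rcases ℓ with _ | ℓ
    · rw [lower_eq_zero_of_mem_zero ζ _ hp, mul_zero]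
      exact isHomogeneous_zero _ _ _
    · convert isHomogeneous_normSqPoly.mul (isHomogeneous_lower ζ hp.1 (ℓ + 1)) using 1
      omega
  have hlin : (linForm n ζ * p).IsHomogeneous (ℓ + 1) :=
    add_comm 1 ℓ ▸ (isHomogeneous_linForm ζ).mul hp.1
  exact hlin.sub hlow

lemma polyLaplacian_raise (ζ : Amb n) {ℓ : ℕ} {p : Poly n} (hp : p ∈ harmonicPoly n ℓ) :
    polyLaplacian n (raise ζ ℓ p) = 0 := by
  have hpΔ : polyLaplacian n p = 0 := hp.2
  rw [raise, map_sub, polyLaplacian_linForm_mul, polyLaplacian_normSqPoly_mul,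
    polyLaplacian_lower ζ ℓ hpΔ, hpΔ, ← smul_lower ζ hp,
    eulerDeriv_of_isHomogeneous (isHomogeneous_lower ζ hp.1 ℓ)]
  rcases ℓ with _ | ℓ
  · simp [lower_eq_zero_of_mem_zero ζ _ hp]
  · simp only [smul_eq_C_mul, map_sub, map_add, map_mul, map_ofNat C 2, Nat.add_sub_cancel,
      Nat.cast_add, Nat.cast_one, C_1, mul_zero, add_zero]
    ring

lemma raise_mem (ζ : Amb n) {ℓ : ℕ} {p : Poly n} (hp : p ∈ harmonicPoly n ℓ) :
    raise ζ ℓ p ∈ harmonicPoly n (ℓ + 1) :=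
  ⟨isHomogeneous_raise ζ hp, polyLaplacian_raise ζ hp⟩

lemma linForm_mul_eq (ζ : Amb n) (ℓ : ℕ) (p : Poly n) :
    linForm n ζ * p = raise ζ ℓ p + normSqPoly n * lower ζ ℓ p := by
  simp [raise]

/-- The ideal generated by `|x|² - 1`, as a real subspace: polynomials vanishing on the sphere. -/
def sphereIdeal (n : ℕ) : Submodule ℝ (Poly n) :=
  (Ideal.span {normSqPoly n - 1}).restrictScalars ℝ

lemma mem_sphereIdeal {p : Poly n} :
    p ∈ sphereIdeal n ↔ ∃ q, p = q * (normSqPoly n - 1) := by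
  simp [sphereIdeal, Ideal.mem_span_singleton', eq_comm]

/-- Polynomials that coincide on the sphere with a sum of harmonics of degree at most `k`. -/
def harmUpTo (n k : ℕ) : Submodule ℝ (Poly n) :=
  (⨆ ℓ ∈ Set.Iic k, harmonicPoly n ℓ) ⊔ sphereIdeal n

lemma harmonicPoly_le_harmUpTo {ℓ k : ℕ} (h : ℓ ≤ k) : harmonicPoly n ℓ ≤ harmUpTo n k :=
  le_sup_of_le_left (le_iSup₂_of_le ℓ h le_rfl)

lemma harmUpTo_mono {k m : ℕ} (h : k ≤ m) : harmUpTo n k ≤ harmUpTo n m :=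
  sup_le (iSup₂_le fun _ hℓ => harmonicPoly_le_harmUpTo (le_trans hℓ h)) le_sup_right

lemma harmUpTo_le {k : ℕ} {S : Submodule ℝ (Poly n)}
    (h1 : ∀ ℓ ≤ k, ∀ p ∈ harmonicPoly n ℓ, p ∈ S) (h2 : ∀ p ∈ sphereIdeal n, p ∈ S) :
    harmUpTo n k ≤ S :=
  sup_le (iSup₂_le fun ℓ hℓ p hp => h1 ℓ hℓ p hp) h2

lemma linForm_mul_mem_harmUpTo_of_mem_harmonicPoly (ζ : Amb n) {ℓ : ℕ} {p : Poly n}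
    (hp : p ∈ harmonicPoly n ℓ) : linForm n ζ * p ∈ harmUpTo n (ℓ + 1) := by
  have heq : linForm n ζ * p =
      raise ζ ℓ p + lower ζ ℓ p + lower ζ ℓ p * (normSqPoly n - 1) := by
    rw [linForm_mul_eq ζ ℓ]; ring
  have hlower : lower ζ ℓ p ∈ harmUpTo n (ℓ + 1) := by
    rcases ℓ with _ | ℓ
    · rw [lower_eq_zero_of_mem_zero ζ _ hp]; exact Submodule.zero_mem _
    · exact harmonicPoly_le_harmUpTo (by omega) (lower_mem ζ hp)
  rw [heq]
  exact add_mem (add_mem (harmonicPoly_le_harmUpTo le_rfl (raise_mem ζ hp)) hlower)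
    (Submodule.mem_sup_right (mem_sphereIdeal.mpr ⟨_, rfl⟩))

lemma linForm_mul_mem_harmUpTo (ζ : Amb n) {k : ℕ} {p : Poly n} (hp : p ∈ harmUpTo n k) :
    linForm n ζ * p ∈ harmUpTo n (k + 1) := by
  have hle : harmUpTo n k ≤ (harmUpTo n (k + 1)).comap (LinearMap.mulLeft ℝ (linForm n ζ)) := by
    refine harmUpTo_le (fun ℓ hℓ p hp => ?_) (fun p hp => ?_)
    · exact harmUpTo_mono (by omega) (linForm_mul_mem_harmUpTo_of_mem_harmonicPoly ζ hp)
    · obtain ⟨q, rfl⟩ := mem_sphereIdeal.mp hp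
      exact Submodule.mem_sup_right
        (mem_sphereIdeal.mpr ⟨linForm n ζ * q, by simp [mul_assoc]⟩)
  exact hle hp

lemma C_mem_harmonicPoly (a : ℝ) : C a ∈ harmonicPoly n 0 :=
  ⟨isHomogeneous_C _ a, by simp [polyLaplacian_apply]⟩

lemma linForm_mem_harmonicPoly (ζ : Amb n) : linForm n ζ ∈ harmonicPoly n 1 :=
  ⟨isHomogeneous_linForm ζ, by simp [polyLaplacian_apply, pderiv_linForm]⟩

lemma exists_mem_harmUpTo (p : Poly n) :
    ∃ k, p ∈ harmUpTo n k := by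
  induction p using MvPolynomial.induction_on with
  | C a => exact ⟨0, harmonicPoly_le_harmUpTo le_rfl (C_mem_harmonicPoly a)⟩
  | add p q hp hq =>
    obtain ⟨k, hk⟩ := hp
    obtain ⟨m, hm⟩ := hq
    exact ⟨max k m, Submodule.add_mem _ (harmUpTo_mono (le_max_left _ _) hk)
      (harmUpTo_mono (le_max_right _ _) hm)⟩
  | mul_X p i hp =>
    obtain ⟨k, hk⟩ := hp
    refine ⟨k + 1, ?_⟩
    have h : linForm n (EuclideanSpace.single i 1) = X i := by
      simp [linForm_apply, ite_smul]
    have := linForm_mul_mem_harmUpTo (EuclideanSpace.single i 1) hk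
    rwa [h, mul_comm] at this

lemma prod_linForm_mem_harmUpTo {k : ℕ} (v : Fin k → Amb n) :
    ∏ i, linForm n (v i) ∈ harmUpTo n k := by
  induction k with
  | zero => simpa using harmonicPoly_le_harmUpTo (n := n) le_rfl (C_mem_harmonicPoly 1)
  | succ k ih =>
    rw [Fin.prod_univ_succ]
    exact linForm_mul_mem_harmUpTo _ (ih _)

/-- The infinitesimal conformal transformation of the sphere in direction `ζ`, acting on functions
of weight `σ`: the vector field `ζ - (ζ · x) x` plus `σ (ζ · x)`. -/
def lieOp (ζ : Amb n) (σ : ℝ) :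
    Poly n →ₗ[ℝ] Poly n :=
  (dirDeriv ζ).toLinearMap - LinearMap.mulLeft ℝ (linForm n ζ) ∘ₗ (eulerDeriv n).toLinearMap +
    σ • LinearMap.mulLeft ℝ (linForm n ζ)

lemma lieOp_apply (ζ : Amb n) (σ : ℝ) (p : Poly n) :
    lieOp ζ σ p = dirDeriv ζ p - linForm n ζ * eulerDeriv n p + σ • (linForm n ζ * p) := rfl

lemma lieOp_mem_sphereIdeal (ζ : Amb n) (σ : ℝ) {p : Poly n}
    (hp : p ∈ sphereIdeal n) : lieOp ζ σ p ∈ sphereIdeal n := by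
  obtain ⟨q, rfl⟩ := mem_sphereIdeal.mp hp
  refine mem_sphereIdeal.mpr ⟨lieOp ζ σ q - 2 * linForm n ζ * q, ?_⟩
  simp only [lieOp_apply, Derivation.leibniz, smul_eq_mul, map_sub, dirDeriv_normSqPoly,
    eulerDeriv_normSqPoly, Derivation.map_one_eq_zero, smul_eq_C_mul]
  ring

lemma lieOp_of_mem_harmonicPoly (ζ : Amb n) (σ : ℝ) {ℓ : ℕ}
    {p : Poly n} (hp : p ∈ harmonicPoly n ℓ) :
    lieOp ζ σ p = (σ - ℓ) • raise ζ ℓ p + (ℓ + n - 1 + σ) • lower ζ ℓ p +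
      ((σ - ℓ) • lower ζ ℓ p) * (normSqPoly n - 1) := by
  rw [lieOp_apply, ← smul_lower ζ hp, eulerDeriv_of_isHomogeneous hp.1, mul_smul_comm,
    linForm_mul_eq ζ ℓ]
  simp only [smul_eq_C_mul, map_sub, map_add, map_mul, map_ofNat C 2]
  ring

lemma lieOp_linForm_pow {e : Amb n} (he : ‖e‖ = 1) (σ : ℝ) (k : ℕ) :
    lieOp e σ (linForm n e ^ k) =
      (k : ℝ) • linForm n e ^ (k - 1) + (σ - k) • linForm n e ^ (k + 1) := by
  have h1 : inner ℝ e e = 1 := by rw [real_inner_self_eq_norm_sq, he]; norm_num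
  rw [lieOp_apply, Derivation.leibniz_pow, Derivation.leibniz_pow, dirDeriv_linForm,
    eulerDeriv_linForm, h1]
  rcases k with _ | k
  · simp
  · simp only [smul_eq_C_mul, nsmul_eq_mul, smul_eq_mul, map_sub, map_natCast, Nat.add_sub_cancel,
      C_1]
    ring

end HarmonicPolynomials

/-! ### The coefficients `alpha` -/

section Alpha

open Asymptotics

lemma Gamma_add_nat_add_one {x : ℝ} (hx : ∀ j : ℕ, x ≠ -j) (m : ℕ) :
    Real.Gamma (x + m + 1) = (∏ j ∈ Finset.range (m + 1), (x + j)) * Real.Gamma x := by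
  have hne : ∀ j : ℕ, x + j ≠ 0 := fun j h => hx j (by linarith)
  induction m with
  | zero => simpa using Real.Gamma_add_one (by simpa using hne 0)
  | succ m ih =>
    rw [Finset.prod_range_succ, mul_right_comm, ← ih, Real.Gamma_add_one (hne _)]
    push_cast
    rw [add_assoc x m 1]
    ring

lemma isEquivalent_Gamma_add_nat_add_one {x : ℝ} (hx : ∀ j : ℕ, x ≠ -j) :
    (fun m : ℕ => Real.Gamma (x + m + 1)) ~[atTop] fun m : ℕ => (m : ℝ) ^ x * m.factorial := by
  have hG : Real.Gamma x ≠ 0 := Real.Gamma_ne_zero hx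
  have h := (tendsto_const_nhds (x := Real.Gamma x)).div (Real.GammaSeq_tendsto_Gamma x) hG
  rw [div_self hG] at h
  refine isEquivalent_of_tendsto_one (h.congr fun m => ?_)
  rw [Pi.div_apply, Pi.div_apply, Real.GammaSeq, Gamma_add_nat_add_one hx m, div_div_eq_mul_div,
    mul_comm]

lemma isEquivalent_lapEig_succ (n : ℕ) :
    (fun m => lapEig n (m + 1)) ~[atTop] fun m : ℕ => (m : ℝ) ^ 2 := by
  have hinv : Tendsto (fun m : ℕ => (m : ℝ)⁻¹) atTop (𝓝 0) :=
    tendsto_inv_atTop_zero.comp tendsto_natCast_atTop_atTop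
  have h : Tendsto (fun m : ℕ => (1 + (m : ℝ)⁻¹) * (1 + n * (m : ℝ)⁻¹)) atTop
      (𝓝 ((1 + 0) * (1 + n * 0))) :=
    (hinv.const_add 1).mul ((hinv.const_mul (n : ℝ)).const_add 1)
  simp only [add_zero, mul_zero, mul_one] at h
  refine isEquivalent_of_tendsto_one (h.congr' ?_)
  filter_upwards [eventually_gt_atTop 0] with m hm
  have : (m : ℝ) ≠ 0 := by exact_mod_cast hm.ne'
  simp only [Pi.div_apply, lapEig]
  push_cast
  field_simp
  ring

/-- The orders for which the optimizers are analyzed: `s - n/2` is positive and not an integer, so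
that `H^s` embeds into the continuous functions and no coefficient `alpha n s ℓ` vanishes. -/
structure IsAdmissible (n : ℕ) (s : ℝ) : Prop where
  half_lt : (n : ℝ) / 2 < s
  ne_nat (m : ℕ) : s - n / 2 ≠ m

namespace IsAdmissible

variable {n : ℕ} {s : ℝ} (hs : IsAdmissible n s)

include hs

lemma order_pos : 0 < s - (n : ℝ) / 2 := sub_pos.mpr hs.half_lt

lemma pos : 0 < s := lt_of_le_of_lt (by positivity) hs.half_lt

lemma add_half_sub_ne_neg (ℓ m : ℕ) : (ℓ : ℝ) + n / 2 - s ≠ -m := fun h =>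
  hs.ne_nat (ℓ + m) (by push_cast; linarith)

lemma alpha_succ (ℓ : ℕ) :
    alpha n s (ℓ + 1) * (ℓ + n / 2 - s) = alpha n s ℓ * (ℓ + n / 2 + s) := by
  have hminus : (ℓ : ℝ) + n / 2 - s ≠ 0 := by simpa using hs.add_half_sub_ne_neg ℓ 0
  have hplus : (ℓ : ℝ) + n / 2 + s ≠ 0 := by have := hs.pos; positivity
  have hG : Real.Gamma (ℓ + n / 2 - s) ≠ 0 := Real.Gamma_ne_zero (hs.add_half_sub_ne_neg ℓ)
  unfold alpha
  rw [show ((ℓ + 1 : ℕ) : ℝ) + n / 2 + s = (ℓ + n / 2 + s) + 1 by push_cast; ring,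
    show ((ℓ + 1 : ℕ) : ℝ) + n / 2 - s = (ℓ + n / 2 - s) + 1 by push_cast; ring,
    Real.Gamma_add_one hminus, Real.Gamma_add_one hplus]
  generalize (ℓ : ℝ) + n / 2 - s = y at hminus hG
  field_simp

lemma alpha_ne_zero (ℓ : ℕ) : alpha n s ℓ ≠ 0 := by
  have hpos := hs.pos
  exact div_ne_zero (Real.Gamma_pos_of_pos (by positivity)).ne'
    (Real.Gamma_ne_zero (hs.add_half_sub_ne_neg ℓ))

lemma alpha_pos_of_lt {ℓ : ℕ} (hℓ : s - n / 2 < ℓ) : 0 < alpha n s ℓ := by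
  have hpos := hs.pos
  exact div_pos (Real.Gamma_pos_of_pos (by positivity)) (Real.Gamma_pos_of_pos (by linarith))

lemma isEquivalent_alpha : alpha n s ~[atTop] fun ℓ => lapEig n ℓ ^ s := by
  have hplus : ∀ j : ℕ, (n : ℝ) / 2 + s ≠ -j := fun j => by
    have := hs.pos
    exact (lt_of_le_of_lt (by simp) (by positivity : 0 < (n : ℝ) / 2 + s)).ne'
  have hminus : ∀ j : ℕ, (n : ℝ) / 2 - s ≠ -j := fun j => by
    simpa using hs.add_half_sub_ne_neg 0 j
  have hGamma := (isEquivalent_Gamma_add_nat_add_one hplus).div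
    (isEquivalent_Gamma_add_nat_add_one hminus)
  have hlap := IsEquivalent.rpow (r := s) (fun m => by positivity) (isEquivalent_lapEig_succ n)
  have hpow : (fun m : ℕ => ((m : ℝ) ^ (n / 2 + s) * m.factorial) /
      ((m : ℝ) ^ (n / 2 - s) * m.factorial)) =ᶠ[atTop] fun m : ℕ => ((m : ℝ) ^ 2) ^ s := by
    filter_upwards [eventually_gt_atTop 0] with m hm
    have hm0 : (0 : ℝ) < m := by exact_mod_cast hm
    rw [mul_div_mul_right _ _ (by positivity), ← Real.rpow_sub hm0, ← Real.rpow_natCast (m : ℝ) 2,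
      ← Real.rpow_mul hm0.le]
    congr 1
    push_cast
    ring
  have hsucc : (fun m => alpha n s (m + 1)) ~[atTop] fun m => lapEig n (m + 1) ^ s := by
    refine ((hGamma.congr_right hpow).congr_left (Eventually.of_forall fun m => ?_)).trans hlap.symm
    rw [Pi.div_apply, alpha]
    congr 2 <;> push_cast <;> ring
  rw [← map_add_atTop_eq_nat 1]
  exact isEquivalent_map.mpr hsucc

lemma exists_abs_alpha_le : ∃ C > 0, ∀ ℓ, |alpha n s ℓ| ≤ C * (1 + lapEig n ℓ ^ s) := by
  have hpow : ∀ ℓ, 0 ≤ lapEig n ℓ ^ s := fun ℓ => Real.rpow_nonneg (lapEig_nonneg n ℓ) s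
  have hO : (fun ℓ => lapEig n ℓ ^ s) =O[atTop] fun ℓ => 1 + lapEig n ℓ ^ s :=
    isBigO_of_le _ fun ℓ => by
      rw [Real.norm_of_nonneg (hpow ℓ), Real.norm_of_nonneg (by linarith [hpow ℓ])]
      linarith
  obtain ⟨C, hC, h⟩ := bound_of_isBigO_nat_atTop (hs.isEquivalent_alpha.isBigO.trans hO)
  refine ⟨C, hC, fun ℓ => ?_⟩
  have hℓ : 0 < 1 + lapEig n ℓ ^ s := by linarith [hpow ℓ]
  simpa only [Real.norm_eq_abs, abs_of_pos hℓ] using h hℓ.ne'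

lemma exists_lapEig_rpow_le : ∃ C > 0, ∀ ℓ, lapEig n ℓ ^ s ≤ C * |alpha n s ℓ| := by
  obtain ⟨C, hC, h⟩ := bound_of_isBigO_nat_atTop hs.isEquivalent_alpha.isBigO_symm
  exact ⟨C, hC, fun ℓ => (le_abs_self _).trans (h (hs.alpha_ne_zero ℓ))⟩

end IsAdmissible

end Alpha

/-! ### Polynomials in `L²` of the sphere -/

section RestrictPoly

variable {n : ℕ}

/-- Restriction of a polynomial to the sphere as a continuous function. -/
def polyCont (n : ℕ) : Poly n →ₐ[ℝ] C(Sph n, ℝ) :=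
  MvPolynomial.aeval (coord n)

lemma polyCont_apply (p : Poly n) (ω : Sph n) :
    polyCont n p ω = MvPolynomial.eval ω.1.ofLp p := by
  unfold polyCont
  induction p using MvPolynomial.induction_on with
  | C a => simp
  | add p q hp hq => simp [hp, hq]
  | mul_X p i hp => simp [hp, coord]

lemma restrictPoly_apply (p : Poly n) :
    restrictPoly n p = ContinuousMap.toLp 2 (surf n) ℝ (polyCont n p) := rfl

lemma inner_toLp (f g : C(Sph n, ℝ)) :
    inner ℝ (ContinuousMap.toLp 2 (surf n) ℝ f) (ContinuousMap.toLp 2 (surf n) ℝ g) =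
      ∫ ω, f ω * g ω ∂(surf n) := by
  rw [ContinuousMap.inner_toLp]
  simp [mul_comm]

lemma polyCont_linForm (ζ : Amb n) (ω : Sph n) :
    polyCont n (linForm n ζ) ω = inner ℝ ζ (ω : Amb n) := by
  simp [polyCont_apply, linForm_apply, PiLp.inner_apply, mul_comm]

lemma polyCont_normSqPoly : polyCont n (normSqPoly n) = 1 := by
  ext ω
  have h : ‖(ω : Amb n)‖ ^ 2 = ∑ i, ω.1.ofLp i ^ 2 := EuclideanSpace.real_norm_sq_eq _
  simp [polyCont_apply, normSqPoly, ← h]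

lemma restrictPoly_eq_zero {p : Poly n} (hp : p ∈ sphereIdeal n) : restrictPoly n p = 0 := by
  obtain ⟨q, rfl⟩ := mem_sphereIdeal.mp hp
  rw [restrictPoly_apply, map_mul, map_sub, polyCont_normSqPoly, map_one, sub_self, mul_zero,
    map_zero]

lemma inner_eq_zero_of_mem_sphHarm {k m : ℕ} (hkm : k ≠ m) {u v : L2 n} (hu : u ∈ sphHarm n k)
    (hv : v ∈ sphHarm n m) : inner ℝ u v = 0 := by
  obtain ⟨p, hp, rfl⟩ := hu
  obtain ⟨q, hq, rfl⟩ := hv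
  rw [restrictPoly_apply, restrictPoly_apply, inner_toLp]
  simpa only [polyCont_apply, ← map_mul] using integral_mul_harmonicPoly_eq_zero hkm hp hq

lemma restrictPoly_mem_sphHarm {k : ℕ} {p : Poly n} (hp : p ∈ harmonicPoly n k) :
    restrictPoly n p ∈ sphHarm n k := ⟨p, hp, rfl⟩

lemma proj_mem (ℓ : ℕ) (u : L2 n) : proj n ℓ u ∈ sphHarm n ℓ :=
  (sphHarm n ℓ).starProjection_apply_mem u

lemma proj_eq_self {ℓ : ℕ} {u : L2 n} (hu : u ∈ sphHarm n ℓ) : proj n ℓ u = u :=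
  Submodule.starProjection_eq_self_iff.mpr hu

lemma proj_eq_zero_of_mem_of_ne {k m : ℕ} (hkm : m ≠ k) {u : L2 n} (hu : u ∈ sphHarm n k) :
    proj n m u = 0 :=
  (Submodule.starProjection_apply_eq_zero_iff _).mpr <| (Submodule.mem_orthogonal _ _).mpr
    fun _ hv => inner_eq_zero_of_mem_sphHarm hkm hv hu

lemma inner_proj_left {ℓ : ℕ} {v : L2 n} (u : L2 n) (hv : v ∈ sphHarm n ℓ) :
    inner ℝ (proj n ℓ u) v = inner ℝ u v := by
  rw [proj, Submodule.inner_starProjection_left_eq_right, ← proj, proj_eq_self hv]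

lemma proj_restrictPoly_eq_zero {k ℓ : ℕ} (h : k < ℓ) {p : Poly n} (hp : p ∈ harmUpTo n k) :
    proj n ℓ (restrictPoly n p) = 0 := by
  have hle : harmUpTo n k ≤ LinearMap.ker ((proj n ℓ).toLinearMap ∘ₗ restrictPoly n) := by
    refine harmUpTo_le (fun m hm p hp => ?_) (fun p hp => ?_)
    · exact proj_eq_zero_of_mem_of_ne (by omega) (restrictPoly_mem_sphHarm hp)
    · change proj n ℓ (restrictPoly n p) = 0
      rw [restrictPoly_eq_zero hp, map_zero]
  exact hle hp

lemma orthogonalFamily_sphHarm (n : ℕ) :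
    OrthogonalFamily ℝ (fun ℓ => sphHarm n ℓ) fun ℓ => (sphHarm n ℓ).subtypeₗᵢ :=
  fun _ _ hkm u v => inner_eq_zero_of_mem_sphHarm hkm u.2 v.2

lemma sum_norm_proj_sq_le (S : Finset ℕ) (u : L2 n) : ∑ ℓ ∈ S, ‖proj n ℓ u‖ ^ 2 ≤ ‖u‖ ^ 2 := by
  have hsum : ‖∑ ℓ ∈ S, proj n ℓ u‖ ^ 2 = ∑ ℓ ∈ S, ‖proj n ℓ u‖ ^ 2 :=
    (orthogonalFamily_sphHarm n).norm_sum (fun ℓ => ⟨proj n ℓ u, proj_mem ℓ u⟩) S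
  have hinner : inner ℝ u (∑ ℓ ∈ S, proj n ℓ u) = ∑ ℓ ∈ S, ‖proj n ℓ u‖ ^ 2 := by
    rw [inner_sum]
    refine Finset.sum_congr rfl fun ℓ _ => ?_
    rw [← inner_proj_left u (proj_mem ℓ u), real_inner_self_eq_norm_sq]
  have hsub := norm_sub_sq_real u (∑ ℓ ∈ S, proj n ℓ u)
  nlinarith [sq_nonneg ‖u - ∑ ℓ ∈ S, proj n ℓ u‖]

end RestrictPoly

/-! ### The Sobolev space -/

section Sobolev

variable {n : ℕ} {s : ℝ}

lemma summable_norm_proj_sq (u : L2 n) : Summable fun ℓ => ‖proj n ℓ u‖ ^ 2 :=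
  summable_of_sum_le (fun _ => sq_nonneg _) fun S => sum_norm_proj_sq_le S u

lemma tsum_norm_proj_sq_le (u : L2 n) : ∑' ℓ, ‖proj n ℓ u‖ ^ 2 ≤ ‖u‖ ^ 2 :=
  (summable_norm_proj_sq u).tsum_le_of_sum_le fun S => sum_norm_proj_sq_le S u

lemma lapEig_rpow_nonneg (n ℓ : ℕ) (s : ℝ) : 0 ≤ lapEig n ℓ ^ s :=
  Real.rpow_nonneg (lapEig_nonneg n ℓ) s

lemma monotone_lapEig (n : ℕ) : Monotone (lapEig n) := fun ℓ k h => by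
  rcases ℓ with _ | ℓ
  · simpa [lapEig] using lapEig_nonneg n k
  · have h1 : ((ℓ + 1 : ℕ) : ℝ) ≤ k := by exact_mod_cast h
    have h2 : (0 : ℝ) ≤ ((ℓ + 1 : ℕ) : ℝ) + n - 1 := by push_cast; linarith [n.cast_nonneg (α := ℝ)]
    unfold lapEig
    gcongr

lemma Sob.toL2_injective : Function.Injective (Sob.toL2 (n := n) (s := s)) :=
  Subtype.coe_injective

lemma Sob.summable_lapEig (u : Sob n s) :
    Summable fun ℓ => lapEig n ℓ ^ s * ‖proj n ℓ u.toL2‖ ^ 2 := by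
  have h : Memℓp (fracCoeff n s u.toL2) 2 := u.2
  refine (h.summable (by norm_num)).congr fun ℓ => ?_
  rw [fracCoeff, norm_smul, ENNReal.toReal_ofNat, Real.rpow_two, mul_pow, Real.norm_eq_abs, sq_abs,
    ← Real.rpow_two, ← Real.rpow_mul (lapEig_nonneg n ℓ)]
  norm_num

lemma Sob.norm_toL2_le (u : Sob n s) : ‖u.toL2‖ ≤ ‖u‖ := by
  have hnonneg : 0 ≤ ∑' ℓ, lapEig n ℓ ^ s * ‖proj n ℓ u.toL2‖ ^ 2 :=
    tsum_nonneg fun ℓ => mul_nonneg (lapEig_rpow_nonneg n ℓ s) (sq_nonneg _)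
  exact (sq_le_sq₀ (norm_nonneg _) (norm_nonneg _)).mp (by linarith [Sob.norm_sq_eq u])

/-- The inclusion of `H^s` in `L²` as a bounded operator. -/
def Sob.toL2CLM (n : ℕ) (s : ℝ) : Sob n s →L[ℝ] L2 n :=
  Sob.toL2.mkContinuous 1 fun u => by simpa using Sob.norm_toL2_le u

lemma Sob.isometry_graph : Isometry (Sob.graph (n := n) (s := s)) :=
  AddMonoidHomClass.isometry_of_norm Sob.graph fun _ => rfl

lemma Sob.range_graph : Set.range (Sob.graph (n := n) (s := s)) =
    ⋂ ℓ : ℕ, {x : WithLp 2 (L2 n × lp (fun _ : ℕ => L2 n) 2) |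
      (x.snd : ∀ _ : ℕ, L2 n) ℓ = (lapEig n ℓ ^ (s / 2)) • proj n ℓ x.fst} := by
  ext x
  simp only [Set.mem_range, Set.mem_iInter]
  constructor
  · rintro ⟨u, rfl⟩ ℓ
    rfl
  · intro hx
    have hfrac : fracCoeff n s x.fst = (x.snd : ∀ _ : ℕ, L2 n) := funext fun ℓ => (hx ℓ).symm
    have hmem : x.fst ∈ sobolevSubmodule n s := by
      change Memℓp (fracCoeff n s x.fst) 2
      exact hfrac ▸ lp.memℓp x.snd
    exact ⟨⟨x.fst, hmem⟩, (WithLp.equiv 2 _).injective (Prod.ext rfl (lp.ext hfrac))⟩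

instance (n : ℕ) (s : ℝ) : CompleteSpace (Sob n s) := by
  have hclosed : IsClosed (Set.range (Sob.graph (n := n) (s := s))) := by
    rw [Sob.range_graph]
    refine isClosed_iInter fun ℓ => isClosed_eq ?_ ?_
    · exact (lp.evalCLM ℝ (fun _ : ℕ => L2 n) 2 ℓ).continuous.comp
        (WithLp.continuous_snd 2 (L2 n) (lp (fun _ : ℕ => L2 n) 2))
    · exact ((proj n ℓ).continuous.comp
        (WithLp.continuous_fst 2 (L2 n) (lp (fun _ : ℕ => L2 n) 2))).const_smul
          (lapEig n ℓ ^ (s / 2))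
  exact (completeSpace_iff_isComplete_range Sob.isometry_graph.isUniformInducing).mpr
    hclosed.isComplete

lemma restrictPoly_mem_sobolevSubmodule (s : ℝ) (p : Poly n) :
    restrictPoly n p ∈ sobolevSubmodule n s := by
  obtain ⟨k, hk⟩ := exists_mem_harmUpTo p
  refine memℓp_gen (summable_of_ne_finset_zero (s := Finset.range (k + 1)) fun ℓ hℓ => ?_)
  rw [Finset.mem_range, not_lt] at hℓ
  rw [fracCoeff, proj_restrictPoly_eq_zero (by omega) hk]
  simp

/-- Restriction of polynomials to the sphere, with values in `H^s`. -/
def polySob (n : ℕ) (s : ℝ) : Poly n →ₗ[ℝ] Sob n s :=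
  (restrictPoly n).codRestrict (sobolevSubmodule n s) (restrictPoly_mem_sobolevSubmodule s)

lemma toL2_polySob (p : Poly n) : (polySob n s p).toL2 = restrictPoly n p := rfl

lemma polySob_eq_zero {p : Poly n} (hp : p ∈ sphereIdeal n) : polySob n s p = 0 :=
  Sob.toL2_injective (by rw [toL2_polySob, restrictPoly_eq_zero hp, map_zero])

lemma norm_sq_polySob_le (hs : 0 ≤ s) {k : ℕ} {p : Poly n} (hp : p ∈ harmUpTo n k) :
    ‖polySob n s p‖ ^ 2 ≤ (1 + lapEig n k ^ s) * ‖restrictPoly n p‖ ^ 2 := by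
  have hle : ∀ ℓ, lapEig n ℓ ^ s * ‖proj n ℓ (restrictPoly n p)‖ ^ 2 ≤
      lapEig n k ^ s * ‖proj n ℓ (restrictPoly n p)‖ ^ 2 := fun ℓ => by
    rcases lt_or_ge k ℓ with hℓ | hℓ
    · simp [proj_restrictPoly_eq_zero hℓ hp]
    · exact mul_le_mul_of_nonneg_right
        (Real.rpow_le_rpow (lapEig_nonneg n ℓ) (monotone_lapEig n hℓ) hs) (sq_nonneg _)
  have htsum := (Sob.summable_lapEig (polySob n s p)).tsum_le_tsum hle
    ((summable_norm_proj_sq _).mul_left _)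
  rw [tsum_mul_left] at htsum
  have hBessel := mul_le_mul_of_nonneg_left (tsum_norm_proj_sq_le (restrictPoly n p))
    (lapEig_rpow_nonneg n k s)
  rw [Sob.norm_sq_eq, toL2_polySob]
  linarith

end Sobolev

/-! ### The bilinear form -/

lemma abs_le_mul_norm_of_abs_le_add_sq {E F : Type*} [NormedAddCommGroup E] [NormedSpace ℝ E]
    [NormedAddCommGroup F] [NormedSpace ℝ F] (B : E →ₗ[ℝ] F →ₗ[ℝ] ℝ) {C : ℝ}
    (hB : ∀ u v, |B u v| ≤ C * (‖u‖ ^ 2 + ‖v‖ ^ 2)) (u : E) (v : F) :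
    |B u v| ≤ 2 * C * ‖u‖ * ‖v‖ := by
  rcases eq_or_ne u 0 with rfl | hu
  · simp
  rcases eq_or_ne v 0 with rfl | hv
  · simp
  have hu' : 0 < ‖u‖ := norm_pos_iff.mpr hu
  have hv' : 0 < ‖v‖ := norm_pos_iff.mpr hv
  have h := hB (‖u‖⁻¹ • u) (‖v‖⁻¹ • v)
  rw [norm_smul, norm_smul, norm_inv, norm_inv, norm_norm, norm_norm, inv_mul_cancel₀ hu'.ne',
    inv_mul_cancel₀ hv'.ne', map_smul, map_smul, LinearMap.smul_apply, smul_eq_mul, smul_eq_mul,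
    abs_mul, abs_mul, abs_of_pos (inv_pos.mpr hu'), abs_of_pos (inv_pos.mpr hv'), ← mul_assoc,
    ← mul_inv, inv_mul_le_iff₀ (by positivity)] at h
  linarith

section Form

variable {n : ℕ} {s : ℝ}

lemma aForm_comm (u v : Sob n s) : aForm u v = aForm v u :=
  tsum_congr fun ℓ => by rw [real_inner_comm]

variable (hs : IsAdmissible n s)

include hs

lemma exists_abs_aForm_le : ∃ C > 0, ∀ u v : Sob n s,
    (Summable fun ℓ => alpha n s ℓ * inner ℝ (proj n ℓ u.toL2) (proj n ℓ v.toL2)) ∧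
      |aForm u v| ≤ C * (‖u‖ ^ 2 + ‖v‖ ^ 2) := by
  obtain ⟨C, hC, hα⟩ := hs.exists_abs_alpha_le
  refine ⟨C, hC, fun u v => ?_⟩
  have hmajor : ∀ w : Sob n s, ∃ S ≤ ‖w‖ ^ 2, HasSum (fun ℓ =>
      (1 + lapEig n ℓ ^ s) * ‖proj n ℓ w.toL2‖ ^ 2) S := fun w => by
    refine ⟨_, ?_, ((summable_norm_proj_sq w.toL2).hasSum.add
      w.summable_lapEig.hasSum).congr_fun fun ℓ => ?_⟩
    · rw [Sob.norm_sq_eq]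
      gcongr
      exact tsum_norm_proj_sq_le _
    · ring
  obtain ⟨S, hS, hu⟩ := hmajor u
  obtain ⟨T, hT, hv⟩ := hmajor v
  have hterm : ∀ ℓ, ‖alpha n s ℓ * inner ℝ (proj n ℓ u.toL2) (proj n ℓ v.toL2)‖ ≤
      C * ((1 + lapEig n ℓ ^ s) * ‖proj n ℓ u.toL2‖ ^ 2 +
        (1 + lapEig n ℓ ^ s) * ‖proj n ℓ v.toL2‖ ^ 2) := fun ℓ => by
    have hinner : |inner ℝ (proj n ℓ u.toL2) (proj n ℓ v.toL2)| ≤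
        ‖proj n ℓ u.toL2‖ ^ 2 + ‖proj n ℓ v.toL2‖ ^ 2 :=
      (abs_real_inner_le_norm _ _).trans (by
        nlinarith [sq_nonneg (‖proj n ℓ u.toL2‖ - ‖proj n ℓ v.toL2‖),
          sq_nonneg (‖proj n ℓ u.toL2‖ + ‖proj n ℓ v.toL2‖)])
    rw [norm_mul, Real.norm_eq_abs, Real.norm_eq_abs, ← mul_add, ← mul_assoc]
    exact mul_le_mul (hα ℓ) hinner (abs_nonneg _) ((abs_nonneg _).trans (hα ℓ))
  have hsum := (hu.add hv).mul_left C
  exact ⟨.of_norm_bounded hsum.summable hterm, (tsum_of_norm_bounded hsum hterm).trans (by gcongr)⟩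

lemma summable_aForm (u v : Sob n s) :
    Summable fun ℓ => alpha n s ℓ * inner ℝ (proj n ℓ u.toL2) (proj n ℓ v.toL2) :=
  ((exists_abs_aForm_le hs).choose_spec.2 u v).1

/-- `a_{2s}` as a bounded bilinear form on `H^s`. -/
def aBil : Sob n s →L[ℝ] Sob n s →L[ℝ] ℝ :=
  have hadd : ∀ u u' v : Sob n s, aForm (u + u') v = aForm u v + aForm u' v := fun u u' v => by
    unfold aForm
    rw [← (summable_aForm hs u v).tsum_add (summable_aForm hs u' v)]
    exact tsum_congr fun ℓ => by rw [map_add, map_add, inner_add_left, mul_add]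
  have hsmul : ∀ (c : ℝ) (u v : Sob n s), aForm (c • u) v = c * aForm u v := fun c u v => by
    unfold aForm
    rw [← tsum_mul_left]
    exact tsum_congr fun ℓ => by rw [map_smul, map_smul, real_inner_smul_left, mul_left_comm]
  let B : Sob n s →ₗ[ℝ] Sob n s →ₗ[ℝ] ℝ := LinearMap.mk₂ ℝ aForm hadd hsmul
    (fun u v v' => by rw [aForm_comm, hadd, aForm_comm v u, aForm_comm v' u])
    (fun c u v => by rw [aForm_comm, hsmul, aForm_comm v u, smul_eq_mul])
  B.mkContinuousOfExistsBound₂ <| by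
    obtain ⟨C, _, hC⟩ := exists_abs_aForm_le hs
    exact ⟨2 * C, abs_le_mul_norm_of_abs_le_add_sq B fun u v => (hC u v).2⟩

lemma aBil_apply (u v : Sob n s) : aBil hs u v = aForm u v := rfl

lemma aBil_comm (u v : Sob n s) : aBil hs u v = aBil hs v u := aForm_comm u v

lemma aBil_polySob (u : Sob n s) {k : ℕ} {p : Poly n} (hp : p ∈ harmonicPoly n k) :
    aBil hs u (polySob n s p) = alpha n s k * inner ℝ u.toL2 (restrictPoly n p) := by
  have hmem := restrictPoly_mem_sphHarm hp
  rw [aBil_apply, aForm, tsum_eq_single k, toL2_polySob, proj_eq_self hmem, inner_proj_left _ hmem]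
  intro ℓ hℓ
  rw [toL2_polySob, proj_eq_zero_of_mem_of_ne hℓ hmem, inner_zero_right, mul_zero]

lemma exists_lapEig_rpow_le_alpha_add :
    ∃ C D : ℝ, 0 < C ∧ 0 < D ∧ ∀ ℓ, lapEig n ℓ ^ s ≤ C * alpha n s ℓ + D := by
  obtain ⟨C, hC, hle⟩ := hs.exists_lapEig_rpow_le
  obtain ⟨N, hN⟩ := exists_nat_gt (s - n / 2)
  have hnonneg : ∀ ℓ, 0 ≤ 2 * C * |alpha n s ℓ| := fun ℓ => by positivity
  have hsum : 0 ≤ ∑ ℓ ∈ Finset.range N, 2 * C * |alpha n s ℓ| :=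
    Finset.sum_nonneg fun ℓ _ => hnonneg ℓ
  refine ⟨C, ∑ ℓ ∈ Finset.range N, 2 * C * |alpha n s ℓ| + 1, hC, by linarith,
    fun ℓ => (hle ℓ).trans ?_⟩
  rcases lt_or_ge ℓ N with hℓ | hℓ
  · have hterm := Finset.single_le_sum (fun i _ => hnonneg i) (Finset.mem_range.mpr hℓ)
    nlinarith [neg_abs_le (alpha n s ℓ)]
  · rw [abs_of_pos (hs.alpha_pos_of_lt (hN.trans_le (by exact_mod_cast hℓ)))]
    linarith

lemma exists_garding_inequality :
    ∃ C D : ℝ, 0 < C ∧ 0 < D ∧ ∀ u : Sob n s, ‖u‖ ^ 2 ≤ C * aBil hs u u + D * ‖u.toL2‖ ^ 2 := by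
  obtain ⟨C, D, hC, hD, hle⟩ := exists_lapEig_rpow_le_alpha_add hs
  refine ⟨C, 1 + D, hC, by positivity, fun u => ?_⟩
  have hA := (summable_aForm hs u u).mul_left C
  have hP := (summable_norm_proj_sq u.toL2).mul_left D
  have hterm : ∀ ℓ, lapEig n ℓ ^ s * ‖proj n ℓ u.toL2‖ ^ 2 ≤
      C * (alpha n s ℓ * inner ℝ (proj n ℓ u.toL2) (proj n ℓ u.toL2)) +
        D * ‖proj n ℓ u.toL2‖ ^ 2 := fun ℓ => by
    rw [real_inner_self_eq_norm_sq, ← mul_assoc, ← add_mul]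
    exact mul_le_mul_of_nonneg_right (hle ℓ) (sq_nonneg _)
  have htsum := (Sob.summable_lapEig u).tsum_le_tsum hterm (hA.add hP)
  rw [hA.tsum_add hP, tsum_mul_left, tsum_mul_left] at htsum
  have hBessel := mul_le_mul_of_nonneg_left (tsum_norm_proj_sq_le u.toL2) hD.le
  rw [Sob.norm_sq_eq, aBil_apply, aForm]
  linarith

end Form

/-! ### Conformal invariance of the form -/

section LieInvariance

variable {n : ℕ} {s : ℝ}

lemma restrictPoly_linForm_mul (e : Amb n) (ℓ : ℕ) (p : Poly n) :
    restrictPoly n (linForm n e * p) =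
      restrictPoly n (raise e ℓ p) + restrictPoly n (lower e ℓ p) := by
  have heq : linForm n e * p =
      raise e ℓ p + lower e ℓ p + lower e ℓ p * (normSqPoly n - 1) := by
    rw [linForm_mul_eq e ℓ]; ring
  rw [heq, map_add, map_add, restrictPoly_eq_zero (mem_sphereIdeal.mpr ⟨_, rfl⟩), add_zero]

lemma inner_raise_of_ne (e : Amb n) {k m : ℕ} (hkm : m ≠ k + 1) {p q : Poly n}
    (hp : p ∈ harmonicPoly n k) (hq : q ∈ harmonicPoly n m) :
    inner ℝ (restrictPoly n (raise e k p)) (restrictPoly n q) = 0 :=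
  inner_eq_zero_of_mem_sphHarm hkm.symm (restrictPoly_mem_sphHarm (raise_mem e hp))
    (restrictPoly_mem_sphHarm hq)

lemma inner_lower_of_ne (e : Amb n) {k m : ℕ} (hkm : k ≠ m + 1) {p q : Poly n}
    (hp : p ∈ harmonicPoly n k) (hq : q ∈ harmonicPoly n m) :
    inner ℝ (restrictPoly n (lower e k p)) (restrictPoly n q) = 0 := by
  rcases k with _ | k
  · rw [lower_eq_zero_of_mem_zero e _ hp, map_zero, inner_zero_left]
  · exact inner_eq_zero_of_mem_sphHarm (by omega) (restrictPoly_mem_sphHarm (lower_mem e hp))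
      (restrictPoly_mem_sphHarm hq)

lemma inner_linForm_mul_comm (e : Amb n) (p q : Poly n) :
    inner ℝ (restrictPoly n (linForm n e * p)) (restrictPoly n q) =
      inner ℝ (restrictPoly n (linForm n e * q)) (restrictPoly n p) := by
  simp only [restrictPoly_apply, inner_toLp, map_mul, ContinuousMap.mul_apply]
  exact integral_congr_ae (.of_forall fun ω => by ring)

lemma restrictPoly_lieOp (e : Amb n) (σ : ℝ) {k : ℕ} {p : Poly n} (hp : p ∈ harmonicPoly n k) :
    restrictPoly n (lieOp e σ p) = (σ - k) • restrictPoly n (raise e k p) +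
      (k + n - 1 + σ) • restrictPoly n (lower e k p) := by
  rw [lieOp_of_mem_harmonicPoly e σ hp, map_add, map_add,
    restrictPoly_eq_zero (mem_sphereIdeal.mpr ⟨_, rfl⟩), add_zero, map_smul, map_smul]

lemma inner_lieOp_succ (e : Amb n) (σ : ℝ) {k : ℕ} {p q : Poly n} (hp : p ∈ harmonicPoly n k)
    (hq : q ∈ harmonicPoly n (k + 1)) :
    inner ℝ (restrictPoly n (lieOp e σ p)) (restrictPoly n q) =
      (σ - k) * inner ℝ (restrictPoly n (linForm n e * p)) (restrictPoly n q) := by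
  rw [restrictPoly_lieOp e σ hp, restrictPoly_linForm_mul e k, inner_add_left, inner_add_left,
    real_inner_smul_left, real_inner_smul_left, inner_lower_of_ne e (by omega) hp hq]
  ring

lemma inner_lieOp_pred (e : Amb n) (σ : ℝ) {k : ℕ} {p q : Poly n} (hp : p ∈ harmonicPoly n k)
    (hq : q ∈ harmonicPoly n (k + 1)) :
    inner ℝ (restrictPoly n (lieOp e σ q)) (restrictPoly n p) =
      (k + n + σ) * inner ℝ (restrictPoly n (linForm n e * p)) (restrictPoly n q) := by
  rw [inner_linForm_mul_comm e p q, restrictPoly_lieOp e σ hq,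
    restrictPoly_linForm_mul e (k + 1), inner_add_left, inner_add_left,
    real_inner_smul_left, real_inner_smul_left, inner_raise_of_ne e (by omega) hq hp]
  push_cast
  ring

variable (hs : IsAdmissible n s)

lemma aBil_lieOp_succ (e : Amb n) {k : ℕ} {p q : Poly n} (hp : p ∈ harmonicPoly n k)
    (hq : q ∈ harmonicPoly n (k + 1)) :
    aBil hs (polySob n s (lieOp e (s - n / 2) p)) (polySob n s q) +
      aBil hs (polySob n s (lieOp e (s - n / 2) q)) (polySob n s p) = 0 := by
  rw [aBil_polySob hs _ hq, aBil_polySob hs _ hp, toL2_polySob, toL2_polySob,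
    inner_lieOp_succ e _ hp hq, inner_lieOp_pred e _ hp hq]
  linear_combination (-inner ℝ (restrictPoly n (linForm n e * p)) (restrictPoly n q)) *
    hs.alpha_succ k

lemma aBil_lieOp_of_mem_harmonicPoly (e : Amb n) {k m : ℕ} {p q : Poly n}
    (hp : p ∈ harmonicPoly n k) (hq : q ∈ harmonicPoly n m) :
    aBil hs (polySob n s (lieOp e (s - n / 2) p)) (polySob n s q) +
      aBil hs (polySob n s (lieOp e (s - n / 2) q)) (polySob n s p) = 0 := by
  by_cases hm : m = k + 1
  · subst hm; exact aBil_lieOp_succ hs e hp hq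
  by_cases hk : k = m + 1
  · subst hk; rw [add_comm]; exact aBil_lieOp_succ hs e hq hp
  rw [aBil_polySob hs _ hq, aBil_polySob hs _ hp, toL2_polySob, toL2_polySob,
    restrictPoly_lieOp e _ hp, restrictPoly_lieOp e _ hq]
  simp only [inner_add_left, real_inner_smul_left, inner_raise_of_ne e hm hp hq,
    inner_raise_of_ne e hk hq hp, inner_lower_of_ne e hk hp hq, inner_lower_of_ne e hm hq hp]
  ring

lemma aBil_lieOp (e : Amb n) (p q : Poly n) :
    aBil hs (polySob n s (lieOp e (s - n / 2) p)) (polySob n s q) +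
      aBil hs (polySob n s (lieOp e (s - n / 2) q)) (polySob n s p) = 0 := by
  let S : Poly n → Submodule ℝ (Poly n) := fun q =>
    LinearMap.ker (((aBil hs).flip (polySob n s q)).toLinearMap ∘ₗ polySob n s ∘ₗ
      lieOp e (s - n / 2) +
      (aBil hs (polySob n s (lieOp e (s - n / 2) q))).toLinearMap ∘ₗ polySob n s)
  have hS : ∀ p q, p ∈ S q ↔
      aBil hs (polySob n s (lieOp e (s - n / 2) p)) (polySob n s q) +
      aBil hs (polySob n s (lieOp e (s - n / 2) q)) (polySob n s p) = 0 := fun _ _ => Iff.rfl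
  have hsymm : ∀ p q, p ∈ S q → q ∈ S p := fun p q h => by
    rw [hS] at h ⊢; rw [add_comm]; exact h
  have hideal : ∀ q, sphereIdeal n ≤ S q := fun q p hp => by
    rw [hS, polySob_eq_zero hp, polySob_eq_zero (lieOp_mem_sphereIdeal e _ hp)]
    simp
  have hharm : ∀ m, ∀ q ∈ harmonicPoly n m, ∀ p, p ∈ S q := fun m q hq p => by
    obtain ⟨k, hk⟩ := exists_mem_harmUpTo p
    exact harmUpTo_le (fun ℓ _ p hp => (hS p q).mpr (aBil_lieOp_of_mem_harmonicPoly hs e hp hq))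
      (hideal q) hk
  obtain ⟨k, hk⟩ := exists_mem_harmUpTo p
  exact (hS p q).mp (harmUpTo_le (fun ℓ _ p hp => hsymm _ _ (hharm ℓ p hp q)) (hideal q) hk)

/-- The infinitesimal conformal transformation `lieOp e (s - n/2)` as a closed relation on `H^s`,
where it is unbounded: the closure of its graph over the polynomials. -/
def lieGraph (s : ℝ) (e : Amb n) : Submodule ℝ (Sob n s × Sob n s) :=
  (LinearMap.range ((polySob n s).prod (polySob n s ∘ₗ lieOp e (s - n / 2)))).topologicalClosure

lemma isClosed_lieGraph (s : ℝ) (e : Amb n) :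
    IsClosed (lieGraph s e : Set (Sob n s × Sob n s)) :=
  Submodule.isClosed_topologicalClosure _

lemma polySob_mem_lieGraph (s : ℝ) (e : Amb n) (p : Poly n) :
    (polySob n s p, polySob n s (lieOp e (s - n / 2) p)) ∈ lieGraph s e :=
  Submodule.le_topologicalClosure _ ⟨p, rfl⟩

lemma aBil_of_mem_lieGraph {e : Amb n} {x y : Sob n s × Sob n s} (hx : x ∈ lieGraph s e)
    (hy : y ∈ lieGraph s e) : aBil hs x.2 y.1 + aBil hs y.2 x.1 = 0 := by
  have hpoly : ∀ x ∈ lieGraph s e, ∀ q : Poly n, aBil hs x.2 (polySob n s q) +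
      aBil hs (polySob n s (lieOp e (s - n / 2) q)) x.1 = 0 := by
    intro x hx q
    have hclosed : IsClosed {x : Sob n s × Sob n s | aBil hs x.2 (polySob n s q) +
        aBil hs (polySob n s (lieOp e (s - n / 2) q)) x.1 = 0} :=
      isClosed_eq (by fun_prop) continuous_const
    refine closure_minimal ?_ hclosed hx
    rintro _ ⟨p, rfl⟩
    exact aBil_lieOp hs e p q
  have hclosed : IsClosed {y : Sob n s × Sob n s | aBil hs x.2 y.1 + aBil hs y.2 x.1 = 0} :=
    isClosed_eq (by fun_prop) continuous_const
  refine closure_minimal ?_ hclosed hy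
  rintro _ ⟨q, rfl⟩
  exact hpoly x hx q

lemma aBil_self_of_mem_lieGraph {e : Amb n} {x : Sob n s × Sob n s} (hx : x ∈ lieGraph s e) :
    aBil hs x.1 x.2 = 0 := by
  have hskew := aBil_of_mem_lieGraph hs hx hx
  rw [aBil_comm hs x.2 x.1] at hskew
  linarith

end LieInvariance

/-! ### The binomial series in a linear form -/

section Coefficients

/-- The Taylor coefficients of `t ↦ (1 - t) ^ σ`. -/
def binCoeff (σ : ℝ) (k : ℕ) : ℝ := (-1) ^ k * Ring.choose σ k

lemma succ_mul_choose_succ (σ : ℝ) (k : ℕ) :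
    ((k : ℝ) + 1) * Ring.choose σ (k + 1) = (σ - k) * Ring.choose σ k := by
  have hfactor : (Polynomial.X - (k : Polynomial ℤ)).smeval σ = σ - k := by
    simp [Polynomial.smeval_sub, Polynomial.smeval_natCast]
  rw [Ring.choose_eq_smul, Ring.choose_eq_smul, descPochhammer_succ_right, Polynomial.smeval_mul,
    Nat.factorial_succ, hfactor]
  simp only [smul_eq_mul]
  push_cast
  field_simp

lemma binCoeff_zero (σ : ℝ) : binCoeff σ 0 = 1 := by simp [binCoeff]

lemma succ_mul_binCoeff_succ (σ : ℝ) (k : ℕ) :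
    ((k : ℝ) + 1) * binCoeff σ (k + 1) = (k - σ) * binCoeff σ k := by
  unfold binCoeff
  rw [pow_succ]
  linear_combination (-(-1) ^ k) * succ_mul_choose_succ σ k

lemma hasSum_binCoeff (σ : ℝ) {t : ℝ} (ht : |t| < 1) :
    HasSum (fun k => binCoeff σ k * t ^ k) ((1 - t) ^ σ) := by
  have h := (Real.one_add_rpow_hasFPowerSeriesOnBall_zero (a := σ)).hasSum_sub (y := -t)
    (by simpa [edist_eq_enorm_sub, enorm_eq_nnnorm, ← NNReal.coe_lt_coe] using ht)
  simp only [sub_zero, binomialSeries_apply, List.ofFn_const, List.prod_replicate,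
    smul_eq_mul] at h
  rw [sub_eq_add_neg]
  refine h.congr_fun fun k => ?_
  rw [binCoeff, neg_pow t k]; ring

end Coefficients

section BinomImage

variable {n : ℕ} {X Y : Type*} [NormedAddCommGroup X] [NormedSpace ℝ X] [NormedAddCommGroup Y]
  [NormedSpace ℝ Y]

/-- A linear map on polynomials whose norm on products of `k` unit linear forms grows at most
polynomially in `k`. -/
def HasPolyGrowth (Φ : Poly n →ₗ[ℝ] X) : Prop :=
  ∃ (C : ℝ) (M : ℕ), ∀ (k : ℕ) (v : Fin k → Amb n),
    ‖Φ (∏ i, linForm n (v i))‖ ≤ C * ((k : ℝ) + 1) ^ M * ∏ i, ‖v i‖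

lemma HasPolyGrowth.comp {Φ : Poly n →ₗ[ℝ] X} (hΦ : HasPolyGrowth Φ) (T : X →L[ℝ] Y) :
    HasPolyGrowth (T.toLinearMap ∘ₗ Φ) := by
  obtain ⟨C, M, hC⟩ := hΦ
  refine ⟨‖T‖ * C, M, fun k v => (T.le_opNorm _).trans ?_⟩
  rw [mul_assoc, mul_assoc, ← mul_assoc C]
  exact mul_le_mul_of_nonneg_left (hC k v) (norm_nonneg T)

/-- The image under `Φ` of the binomial series of `(1 - ζ · x) ^ σ`. -/
def binomImage (Φ : Poly n →ₗ[ℝ] X) (σ : ℝ) (ζ : Amb n) : X :=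
  ∑' k, binCoeff σ k • Φ (linForm n ζ ^ k)

/-- The image under `Φ` of the Lie derivative `lieOp e σ` of the function `(1 - r e · x) ^ σ` on the
sphere; the formula is the one valid for `‖e‖ = 1`. -/
def binomLie (Φ : Poly n →ₗ[ℝ] X) (σ : ℝ) (e : Amb n) (r : ℝ) : X :=
  -((1 - r ^ 2) • fderiv ℝ (binomImage Φ σ) (r • e) e) - (r * σ) • binomImage Φ σ (r • e)

lemma one_le_radius_of_norm_le {p : FormalMultilinearSeries ℝ (Amb n) X} {σ C : ℝ} {M : ℕ}
    (hp : ∀ k, ‖p k‖ ≤ |binCoeff σ k| * (C * ((k : ℝ) + 1) ^ M)) : 1 ≤ p.radius := by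
  refine ENNReal.le_of_forall_nnreal_lt fun r hr => ?_
  rcases eq_or_ne r 0 with rfl | hr0
  · simp
  have hr1 : (r : ℝ) < 1 := by exact_mod_cast hr
  obtain ⟨ρ, hrρ, hρ1⟩ := exists_between hr1
  have hρ0 : 0 < ρ := r.2.trans_lt hrρ
  have hbin : Tendsto (fun k => |binCoeff σ k * ρ ^ k|) atTop (𝓝 0) := by
    simpa using (hasSum_binCoeff σ
      (by rwa [abs_of_pos hρ0])).summable.tendsto_atTop_zero.abs
  have hgeo : Tendsto (fun k : ℕ => ((k : ℝ) + 1) ^ M * (r / ρ) ^ k) atTop (𝓝 0) := by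
    have hq : 0 < (r : ℝ) / ρ := div_pos (by positivity) hρ0
    have h := ((tendsto_pow_const_mul_const_pow_of_lt_one M hq.le
      ((div_lt_one hρ0).mpr hrρ)).comp (tendsto_add_atTop_nat 1)).mul_const (r / ρ : ℝ)⁻¹
    rw [zero_mul] at h
    refine h.congr fun k => ?_
    simp only [Function.comp_apply]
    rw [pow_succ]
    push_cast
    field_simp
  have hlim := (hbin.mul hgeo).const_mul C
  rw [mul_zero, mul_zero] at hlim
  refine p.le_radius_of_tendsto (squeeze_zero (fun k => by positivity) (fun k => ?_) hlim)
  calc ‖p k‖ * (r : ℝ) ^ k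
      ≤ |binCoeff σ k| * (C * ((k : ℝ) + 1) ^ M) * (r : ℝ) ^ k := by gcongr; exact hp k
    _ = C * (|binCoeff σ k * ρ ^ k| * (((k : ℝ) + 1) ^ M * (r / ρ) ^ k)) := by
      rw [abs_mul (binCoeff σ k), abs_of_pos (pow_pos hρ0 k), div_pow]
      field_simp

variable [CompleteSpace X] {Φ : Poly n →ₗ[ℝ] X}

lemma HasPolyGrowth.exists_hasFPowerSeriesOnBall (hΦ : HasPolyGrowth Φ) (σ : ℝ) :
    ∃ p : FormalMultilinearSeries ℝ (Amb n) X, HasFPowerSeriesOnBall (binomImage Φ σ) p 0 1 ∧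
      ∀ k ζ, (p k fun _ => ζ) = binCoeff σ k • Φ (linForm n ζ ^ k) := by
  obtain ⟨C, M, hC⟩ := hΦ
  let m (k : ℕ) : ContinuousMultilinearMap ℝ (fun _ : Fin k => Amb n) X :=
    (Φ.compMultilinearMap ((MultilinearMap.mkPiAlgebra ℝ (Fin k) (Poly n)).compLinearMap
      fun _ => linForm n)).mkContinuous (C * ((k : ℝ) + 1) ^ M) fun v => by simpa using hC k v
  let p : FormalMultilinearSeries ℝ (Amb n) X := fun k => binCoeff σ k • m k
  have hp (k : ℕ) (ζ : Amb n) : (p k fun _ => ζ) = binCoeff σ k • Φ (linForm n ζ ^ k) := by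
    simp [p, m]
  have hC0 : 0 ≤ C := by simpa using (norm_nonneg _).trans (hC 0 Fin.elim0)
  have hradius : 1 ≤ p.radius := one_le_radius_of_norm_le (σ := σ) (C := C) (M := M) fun k => by
    rw [norm_smul, Real.norm_eq_abs]
    gcongr
    exact MultilinearMap.mkContinuous_norm_le _ (by positivity) _
  refine ⟨p, ?_, hp⟩
  have hsum : p.sum = binomImage Φ σ := funext fun ζ => tsum_congr fun k => hp k ζ
  exact hsum ▸ (p.hasFPowerSeriesOnBall (zero_lt_one.trans_le hradius)).mono zero_lt_one hradius

lemma mem_eball_zero_one {ζ : Amb n} : ζ ∈ Metric.eball (0 : Amb n) 1 ↔ ‖ζ‖ < 1 := by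
  rw [← ENNReal.ofReal_one, Metric.eball_ofReal, mem_ball_zero_iff]

namespace HasPolyGrowth

variable (hΦ : HasPolyGrowth Φ) (σ : ℝ)
include hΦ

lemma hasSum_binomImage {ζ : Amb n} (hζ : ‖ζ‖ < 1) :
    HasSum (fun k => binCoeff σ k • Φ (linForm n ζ ^ k)) (binomImage Φ σ ζ) := by
  obtain ⟨p, hp, hpk⟩ := hΦ.exists_hasFPowerSeriesOnBall σ
  simpa [hpk] using hp.hasSum (mem_eball_zero_one.mpr hζ)

lemma analyticAt_binomImage {ζ : Amb n} (hζ : ‖ζ‖ < 1) : AnalyticAt ℝ (binomImage Φ σ) ζ := by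
  obtain ⟨p, hp, -⟩ := hΦ.exists_hasFPowerSeriesOnBall σ
  exact hp.analyticOnNhd ζ (mem_eball_zero_one.mpr hζ)

lemma hasSum_fderiv_binomImage {e : Amb n} {r : ℝ} (hr : ‖r • e‖ < 1) :
    HasSum (fun k : ℕ => (r ^ k * (k + 1) * binCoeff σ (k + 1)) • Φ (linForm n e ^ (k + 1)))
      (fderiv ℝ (binomImage Φ σ) (r • e) e) := by
  obtain ⟨p, hp, hpk⟩ := hΦ.exists_hasFPowerSeriesOnBall σ
  have h := (ContinuousLinearMap.apply ℝ X e).hasSum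
    (hp.fderiv.hasSum (mem_eball_zero_one.mpr hr))
  rw [zero_add] at h
  refine h.congr_fun fun k => ?_
  have hsmul := (p.derivSeries k).map_smul_univ (fun _ => r) (fun _ => e)
  simp only [Finset.prod_const, Finset.card_univ, Fintype.card_fin] at hsmul
  rw [ContinuousLinearMap.apply_apply, hsmul, smul_apply,
    FormalMultilinearSeries.derivSeries_apply_diag, hpk, ← Nat.cast_smul_eq_nsmul ℝ, smul_smul,
    smul_smul]
  push_cast
  ring_nf

lemma map_binomImage (T : X →L[ℝ] Y) {ζ : Amb n} (hζ : ‖ζ‖ < 1) :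
    T (binomImage Φ σ ζ) = binomImage (T.toLinearMap ∘ₗ Φ) σ ζ := by
  rw [← (T.hasSum (hΦ.hasSum_binomImage σ hζ)).tsum_eq]
  exact tsum_congr fun k => by simp

lemma map_fderiv_binomImage (T : X →L[ℝ] Y) {ζ : Amb n} (hζ : ‖ζ‖ < 1) (e : Amb n) :
    T (fderiv ℝ (binomImage Φ σ) ζ e) = fderiv ℝ (binomImage (T.toLinearMap ∘ₗ Φ) σ) ζ e := by
  have heq : binomImage (T.toLinearMap ∘ₗ Φ) σ =ᶠ[𝓝 ζ] T ∘ binomImage Φ σ := by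
    filter_upwards [continuous_norm.continuousAt.eventually_lt_const hζ] with η hη
    exact (hΦ.map_binomImage σ T hη).symm
  rw [heq.fderiv_eq,
    (T.hasFDerivAt.comp ζ (hΦ.analyticAt_binomImage σ hζ).differentiableAt.hasFDerivAt).fderiv]
  rfl

lemma map_binomLie (T : X →L[ℝ] Y) {e : Amb n} {r : ℝ} (hr : ‖r • e‖ < 1) :
    T (binomLie Φ σ e r) = binomLie (T.toLinearMap ∘ₗ Φ) σ e r := by
  simp only [binomLie, map_sub, map_neg, map_smul, hΦ.map_binomImage σ T hr,
    hΦ.map_fderiv_binomImage σ T hr]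

lemma hasSum_binomImage_smul {e : Amb n} {r : ℝ} (hr : ‖r • e‖ < 1) :
    HasSum (fun k : ℕ => (r ^ k * binCoeff σ k) • Φ (linForm n e ^ k))
      (binomImage Φ σ (r • e)) := by
  refine (hΦ.hasSum_binomImage σ hr).congr_fun fun k => ?_
  rw [map_smul, smul_pow, map_smul, smul_smul, mul_comm]

lemma hasSum_natCast_mul_binomImage_smul {e : Amb n} {r : ℝ} (hr : ‖r • e‖ < 1) :
    HasSum (fun k : ℕ => (r ^ k * binCoeff σ k * k) • Φ (linForm n e ^ k))
      (r • fderiv ℝ (binomImage Φ σ) (r • e) e) := by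
  refine (hasSum_nat_add_iff' 1).mp ?_
  simp only [Finset.range_one, Finset.sum_singleton, Nat.cast_zero, mul_zero, zero_smul, sub_zero]
  refine ((hΦ.hasSum_fderiv_binomImage σ hr).const_smul r).congr_fun fun k => ?_
  rw [smul_smul]
  push_cast
  ring_nf

lemma hasSum_lower_binomImage_smul {e : Amb n} {r : ℝ} (hr : ‖r • e‖ < 1) :
    HasSum (fun k : ℕ => (r ^ k * binCoeff σ k * k) • Φ (linForm n e ^ (k - 1)))
      (r • r • fderiv ℝ (binomImage Φ σ) (r • e) e - (r * σ) • binomImage Φ σ (r • e)) := by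
  refine (hasSum_nat_add_iff' 1).mp ?_
  simp only [Finset.range_one, Finset.sum_singleton, Nat.cast_zero, mul_zero, zero_smul, sub_zero]
  refine (((hΦ.hasSum_natCast_mul_binomImage_smul σ hr).const_smul r).sub
    ((hΦ.hasSum_binomImage_smul σ hr).const_smul (r * σ))).congr_fun fun k => ?_
  rw [smul_smul, smul_smul, ← sub_smul, Nat.add_sub_cancel]
  congr 1
  push_cast
  linear_combination r ^ (k + 1) * succ_mul_binCoeff_succ σ k

lemma hasSum_raise_binomImage_smul {e : Amb n} {r : ℝ} (hr : ‖r • e‖ < 1) :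
    HasSum (fun k : ℕ => (r ^ k * binCoeff σ k * (σ - k)) • Φ (linForm n e ^ (k + 1)))
      (-fderiv ℝ (binomImage Φ σ) (r • e) e) := by
  refine (hΦ.hasSum_fderiv_binomImage σ hr).neg.congr_fun fun k => ?_
  rw [← neg_smul]
  congr 1
  linear_combination r ^ k * succ_mul_binCoeff_succ σ k

lemma hasSum_binomLie {e : Amb n} (he : ‖e‖ = 1) {r : ℝ} (hr : |r| < 1) :
    HasSum (fun k : ℕ => (r ^ k * binCoeff σ k) • Φ (lieOp e σ (linForm n e ^ k)))
      (binomLie Φ σ e r) := by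
  have hre : ‖r • e‖ < 1 := by rwa [norm_smul, he, mul_one]
  have hLie : binomLie Φ σ e r = (r • r • fderiv ℝ (binomImage Φ σ) (r • e) e -
      (r * σ) • binomImage Φ σ (r • e)) + -fderiv ℝ (binomImage Φ σ) (r • e) e := by
    rw [binomLie]
    module
  rw [hLie]
  refine ((hΦ.hasSum_lower_binomImage_smul σ hre).add
    (hΦ.hasSum_raise_binomImage_smul σ hre)).congr_fun fun k => ?_
  rw [lieOp_linForm_pow he, map_add, map_smul, map_smul, smul_add, smul_smul, smul_smul]

end HasPolyGrowth

end BinomImage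

/-! ### The optimizers -/

section Growth

variable {n : ℕ} {s : ℝ}

lemma abs_inner_le_norm (ζ : Amb n) (ω : Sph n) : |inner ℝ ζ (ω : Amb n)| ≤ ‖ζ‖ := by
  simpa using norm_inner_le_norm (𝕜 := ℝ) ζ (ω : Amb n)

lemma one_sub_inner_pos {ζ : Amb n} (hζ : ‖ζ‖ < 1) (ω : Sph n) :
    0 < 1 - inner ℝ ζ (ω : Amb n) :=
  sub_pos.mpr ((le_abs_self _).trans_lt ((abs_inner_le_norm ζ ω).trans_lt hζ))

lemma norm_polyCont_prod_linForm_le {k : ℕ} (v : Fin k → Amb n) :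
    ‖polyCont n (∏ i, linForm n (v i))‖ ≤ ∏ i, ‖v i‖ := by
  refine (ContinuousMap.norm_le _ (by positivity)).mpr fun ω => ?_
  rw [map_prod, ContinuousMap.prod_apply, norm_prod]
  refine Finset.prod_le_prod (fun i _ => norm_nonneg _) fun i _ => ?_
  rw [polyCont_linForm]
  exact abs_inner_le_norm _ ω

lemma hasPolyGrowth_polyCont : HasPolyGrowth (polyCont n).toLinearMap :=
  ⟨1, 0, fun k v => by simpa using norm_polyCont_prod_linForm_le v⟩

lemma lapEig_le_sq (n k : ℕ) : lapEig n k ≤ (((n : ℝ) + 1) * (k + 1)) ^ 2 := by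
  have hn : (0 : ℝ) ≤ n := n.cast_nonneg
  have hk : (0 : ℝ) ≤ k := k.cast_nonneg
  unfold lapEig
  nlinarith [mul_nonneg hn hk, mul_nonneg (mul_nonneg hn hk) hk, mul_nonneg (mul_nonneg hn hk) hn,
    mul_nonneg (mul_nonneg hn hk) (mul_nonneg hn hk)]

lemma one_add_lapEig_rpow_le (hs : 0 ≤ s) (n k : ℕ) :
    1 + lapEig n k ^ s ≤ 2 * (((n : ℝ) + 1) * (k + 1)) ^ ⌈2 * s⌉₊ := by
  have hbase : (1 : ℝ) ≤ ((n : ℝ) + 1) * (k + 1) :=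
    one_le_mul_of_one_le_of_one_le (by simp) (by simp)
  have hpow : lapEig n k ^ s ≤ (((n : ℝ) + 1) * (k + 1)) ^ ⌈2 * s⌉₊ := by
    calc lapEig n k ^ s ≤ ((((n : ℝ) + 1) * (k + 1)) ^ (2 : ℝ)) ^ s :=
          Real.rpow_le_rpow (lapEig_nonneg n k) (by simpa using lapEig_le_sq n k) hs
      _ = (((n : ℝ) + 1) * (k + 1)) ^ (2 * s) := by rw [← Real.rpow_mul (by linarith)]
      _ ≤ (((n : ℝ) + 1) * (k + 1)) ^ (⌈2 * s⌉₊ : ℝ) :=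
          Real.rpow_le_rpow_of_exponent_le hbase (Nat.le_ceil _)
      _ = _ := Real.rpow_natCast _ _
  linarith [one_le_pow₀ hbase (n := ⌈2 * s⌉₊)]

lemma hasPolyGrowth_polySob (hs : 0 ≤ s) : HasPolyGrowth (polySob n s) := by
  set T := ‖(ContinuousMap.toLp 2 (surf n) ℝ : C(Sph n, ℝ) →L[ℝ] L2 n)‖
  refine ⟨2 * ((n : ℝ) + 1) ^ ⌈2 * s⌉₊ * T, ⌈2 * s⌉₊, fun k v => ?_⟩
  have hL2 : ‖restrictPoly n (∏ i, linForm n (v i))‖ ≤ T * ∏ i, ‖v i‖ := by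
    rw [restrictPoly_apply]
    exact (ContinuousLinearMap.le_opNorm _ _).trans
      (mul_le_mul_of_nonneg_left (norm_polyCont_prod_linForm_le v) (norm_nonneg _))
  have hweight : 1 ≤ 1 + lapEig n k ^ s := le_add_of_nonneg_right (lapEig_rpow_nonneg n k s)
  have hSob : ‖polySob n s (∏ i, linForm n (v i))‖ ≤
      (1 + lapEig n k ^ s) * ‖restrictPoly n (∏ i, linForm n (v i))‖ := by
    refine (sq_le_sq₀ (norm_nonneg _) (by positivity)).mp
      ((norm_sq_polySob_le hs (prod_linForm_mem_harmUpTo v)).trans ?_)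
    rw [mul_pow]
    gcongr
    exact le_self_pow₀ hweight two_ne_zero
  calc _ ≤ (1 + lapEig n k ^ s) * (T * ∏ i, ‖v i‖) := hSob.trans (by gcongr)
    _ ≤ 2 * (((n : ℝ) + 1) * (k + 1)) ^ ⌈2 * s⌉₊ * (T * ∏ i, ‖v i‖) := by
      gcongr
      exact one_add_lapEig_rpow_le hs n k
    _ = _ := by rw [mul_pow]; ring

end Growth

section Pointwise

variable {n : ℕ} (σ : ℝ) {ζ : Amb n}

lemma binomImage_polyCont_apply (hζ : ‖ζ‖ < 1) (ω : Sph n) :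
    binomImage (polyCont n).toLinearMap σ ζ ω = (1 - inner ℝ ζ (ω : Amb n)) ^ σ := by
  have h := (ContinuousMap.evalCLM ℝ ω).hasSum (hasPolyGrowth_polyCont.hasSum_binomImage σ hζ)
  refine h.unique ((hasSum_binCoeff σ ((abs_inner_le_norm ζ ω).trans_lt hζ)).congr_fun fun k => ?_)
  simp [polyCont_linForm]

lemma fderiv_binomImage_polyCont_apply (hζ : ‖ζ‖ < 1) (e : Amb n) (ω : Sph n) :
    fderiv ℝ (binomImage (polyCont n).toLinearMap σ) ζ e ω =
      -(σ * inner ℝ e (ω : Amb n) * (1 - inner ℝ ζ (ω : Amb n)) ^ (σ - 1)) := by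
  have hinner : HasFDerivAt (fun η : Amb n => 1 - inner ℝ η (ω : Amb n))
      (-innerSL ℝ (ω : Amb n)) ζ := by
    simpa only [coe_innerSL_apply, real_inner_comm (ω : Amb n)] using
      (innerSL ℝ (ω : Amb n)).hasFDerivAt.const_sub 1
  have hpow := hinner.rpow_const (p := σ) (Or.inl (one_sub_inner_pos hζ ω).ne')
  have heval := (ContinuousMap.evalCLM ℝ ω).hasFDerivAt.comp ζ
    (hasPolyGrowth_polyCont.analyticAt_binomImage σ hζ).differentiableAt.hasFDerivAt
  have heq : (fun η : Amb n => (1 - inner ℝ η (ω : Amb n)) ^ σ) =ᶠ[𝓝 ζ]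
      ContinuousMap.evalCLM ℝ ω ∘ binomImage (polyCont n).toLinearMap σ := by
    filter_upwards [continuous_norm.continuousAt.eventually_lt_const hζ] with η hη
    exact (binomImage_polyCont_apply σ hη ω).symm
  have h := DFunLike.congr_fun ((heval.congr_of_eventuallyEq heq).unique hpow) e
  simp only [smul_apply, neg_apply, innerSL_apply_apply, smul_eq_mul,
    ContinuousLinearMap.comp_apply, ContinuousMap.evalCLM_apply] at h
  rw [h, real_inner_comm e (ω : Amb n)]
  ring

lemma binomLie_polyCont_apply {e : Amb n} {r : ℝ} (hr : ‖r • e‖ < 1) (ω : Sph n) :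
    binomLie (polyCont n).toLinearMap σ e r ω =
      σ * (1 - r * inner ℝ e (ω : Amb n)) ^ (σ - 1) * (inner ℝ e (ω : Amb n) - r) := by
  have hpos := one_sub_inner_pos hr ω
  rw [real_inner_smul_left] at hpos
  simp only [binomLie, ContinuousMap.sub_apply, ContinuousMap.neg_apply, ContinuousMap.smul_apply,
    fderiv_binomImage_polyCont_apply σ hr, binomImage_polyCont_apply σ hr, real_inner_smul_left,
    smul_eq_mul]
  rw [← sub_add_cancel σ 1, Real.rpow_add_one hpos.ne', sub_add_cancel]
  ring

end Pointwise

section Bubble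

variable {n : ℕ} {s : ℝ}

/-- The function `ω ↦ (1 - ζ · ω) ^ (s - n / 2)` as an element of `H^s`, given by its binomial
series. -/
def bubble (n : ℕ) (s : ℝ) (ζ : Amb n) : Sob n s := binomImage (polySob n s) (s - n / 2) ζ

/-- The derivative of the functions `bubble n s (r • e)`, for `‖e‖ = 1`, under the infinitesimal
conformal transformation in direction `e`. -/
def bubbleLie (n : ℕ) (s : ℝ) (e : Amb n) (r : ℝ) : Sob n s :=
  binomLie (polySob n s) (s - n / 2) e r

lemma bubbleLie_eq (e : Amb n) (r : ℝ) : bubbleLie n s e r =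
    -((1 - r ^ 2) • fderiv ℝ (bubble n s) (r • e) e) - (r * (s - n / 2)) • bubble n s (r • e) :=
  rfl

lemma norm_smul_lt_one {e : Amb n} (he : ‖e‖ = 1) {r : ℝ} (hr : |r| < 1) : ‖r • e‖ < 1 := by
  rwa [norm_smul, he, mul_one]

lemma toLinearMap_comp_polySob :
    (Sob.toL2CLM n s).toLinearMap ∘ₗ polySob n s =
      (ContinuousMap.toLp 2 (surf n) ℝ : C(Sph n, ℝ) →L[ℝ] L2 n).toLinearMap ∘ₗ
        (polyCont n).toLinearMap := rfl

lemma toL2_bubble (hs : 0 ≤ s) {ζ : Amb n} (hζ : ‖ζ‖ < 1) :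
    (bubble n s ζ).toL2 = ContinuousMap.toLp 2 (surf n) ℝ
      (binomImage (polyCont n).toLinearMap (s - n / 2) ζ) := by
  rw [hasPolyGrowth_polyCont.map_binomImage _ _ hζ, ← toLinearMap_comp_polySob,
    ← (hasPolyGrowth_polySob hs).map_binomImage _ _ hζ]
  rfl

lemma toL2_bubbleLie (hs : 0 ≤ s) {e : Amb n} {r : ℝ} (hr : ‖r • e‖ < 1) :
    (bubbleLie n s e r).toL2 = ContinuousMap.toLp 2 (surf n) ℝ
      (binomLie (polyCont n).toLinearMap (s - n / 2) e r) := by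
  rw [hasPolyGrowth_polyCont.map_binomLie _ _ hr, ← toLinearMap_comp_polySob,
    ← (hasPolyGrowth_polySob hs).map_binomLie _ _ hr]
  rfl

lemma analyticAt_bubble (hs : 0 ≤ s) {ζ : Amb n} (hζ : ‖ζ‖ < 1) : AnalyticAt ℝ (bubble n s) ζ :=
  (hasPolyGrowth_polySob hs).analyticAt_binomImage _ hζ

lemma bubble_mem_lieGraph (hs : 0 ≤ s) {e : Amb n} (he : ‖e‖ = 1) {r : ℝ} (hr : |r| < 1) :
    (bubble n s (r • e), bubbleLie n s e r) ∈ lieGraph s e := by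
  have hsum := ((hasPolyGrowth_polySob hs).hasSum_binomImage_smul (s - n / 2)
    (norm_smul_lt_one he hr)).prodMk ((hasPolyGrowth_polySob hs).hasSum_binomLie (s - n / 2) he hr)
  exact (isClosed_lieGraph s e).mem_of_tendsto hsum <| .of_forall fun S =>
    Submodule.sum_mem _ fun k _ => Submodule.smul_mem _ _ (polySob_mem_lieGraph s e _)

lemma hasDerivAt_bubble_smul (hs : 0 ≤ s) {e : Amb n} (he : ‖e‖ = 1) {r : ℝ} (hr : |r| < 1) :
    HasDerivAt (fun r : ℝ => bubble n s (r • e)) (fderiv ℝ (bubble n s) (r • e) e) r :=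
  (analyticAt_bubble hs (norm_smul_lt_one he hr)).differentiableAt.hasFDerivAt.comp_hasDerivAt r
    (by simpa using (hasDerivAt_id r).smul_const e)

lemma differentiableAt_bubbleLie (hs : 0 ≤ s) {e : Amb n} (he : ‖e‖ = 1) {r : ℝ} (hr : |r| < 1) :
    DifferentiableAt ℝ (bubbleLie n s e) r := by
  have hbubble := (hasDerivAt_bubble_smul hs he hr).differentiableAt
  have hfderiv : DifferentiableAt ℝ (fun r : ℝ => fderiv ℝ (bubble n s) (r • e)) r :=
    (analyticAt_bubble hs (norm_smul_lt_one he hr)).fderiv.differentiableAt.comp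
      (f := fun r : ℝ => r • e) r (by fun_prop)
  have hLie : bubbleLie n s e = fun r => -((1 - r ^ 2) • fderiv ℝ (bubble n s) (r • e) e) -
      (r * (s - n / 2)) • bubble n s (r • e) := funext (bubbleLie_eq e)
  rw [hLie]
  fun_prop

end Bubble

/-! ### Uniform bounds near the boundary of the ball -/

section UniformBound

lemma mem_of_hasDerivAt {E : Type*} [NormedAddCommGroup E] [NormedSpace ℝ E] {S : Submodule ℝ E}
    (hS : IsClosed (S : Set E)) {f : ℝ → E} {f' : E} {x : ℝ} (hf : HasDerivAt f f' x)
    (hmem : ∀ᶠ y in 𝓝 x, f y ∈ S) : f' ∈ S := by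
  refine hS.mem_of_tendsto (hasDerivAt_iff_tendsto_slope.mp hf) ?_
  filter_upwards [eventually_nhdsWithin_of_eventually_nhds hmem] with y hy
  rw [slope_def_module]
  exact S.smul_mem _ (S.sub_mem hy hmem.self_of_nhds)

lemma abs_sub_le_one_sub_mul {r t : ℝ} (hr : |r| ≤ 1) (ht : |t| ≤ 1) : |t - r| ≤ 1 - r * t := by
  obtain ⟨hr₁, hr₂⟩ := abs_le.mp hr
  obtain ⟨ht₁, ht₂⟩ := abs_le.mp ht
  rw [abs_le]
  constructor <;> nlinarith

lemma abs_mul_rpow_mul_sub_le {σ : ℝ} (hσ : 0 ≤ σ) {r t : ℝ} (hr : |r| < 1) (ht : |t| ≤ 1) :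
    |σ * (1 - r * t) ^ (σ - 1) * (t - r)| ≤ σ * 2 ^ σ := by
  have hrt : |r * t| < 1 := by
    rw [abs_mul]
    exact (mul_le_of_le_one_right (abs_nonneg r) ht).trans_lt hr
  have hpos : 0 < 1 - r * t := sub_pos.mpr (abs_lt.mp hrt).2
  have hnonneg : 0 ≤ (1 - r * t) ^ (σ - 1) := Real.rpow_nonneg hpos.le _
  rw [abs_mul, abs_mul, abs_of_nonneg hσ, abs_of_nonneg hnonneg, mul_assoc]
  gcongr
  calc (1 - r * t) ^ (σ - 1) * |t - r| ≤ (1 - r * t) ^ (σ - 1) * (1 - r * t) := by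
        gcongr
        exact abs_sub_le_one_sub_mul hr.le ht
    _ = (1 - r * t) ^ σ := by rw [← Real.rpow_add_one hpos.ne', sub_add_cancel]
    _ ≤ 2 ^ σ := Real.rpow_le_rpow hpos.le (by linarith [(abs_lt.mp hrt).1]) hσ

variable {n : ℕ} {s : ℝ} (hs : IsAdmissible n s)

include hs

lemma exists_norm_toL2_bubbleLie_le :
    ∃ C : ℝ, ∀ e : Amb n, ‖e‖ = 1 → ∀ r : ℝ, |r| < 1 → ‖(bubbleLie n s e r).toL2‖ ≤ C := by
  have hσ := hs.order_pos
  refine ⟨‖(ContinuousMap.toLp 2 (surf n) ℝ : C(Sph n, ℝ) →L[ℝ] L2 n)‖ *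
    ((s - n / 2) * 2 ^ (s - (n : ℝ) / 2)), fun e he r hr => ?_⟩
  have hre := norm_smul_lt_one he hr
  rw [toL2_bubbleLie hs.pos.le hre]
  refine (ContinuousLinearMap.le_opNorm _ _).trans (mul_le_mul_of_nonneg_left ?_ (norm_nonneg _))
  refine (ContinuousMap.norm_le _ (by positivity)).mpr fun ω => ?_
  rw [binomLie_polyCont_apply _ hre, Real.norm_eq_abs]
  exact abs_mul_rpow_mul_sub_le hσ.le hr (by simpa [he] using abs_inner_le_norm e ω)

variable {e : Amb n} (he : ‖e‖ = 1) {r : ℝ}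

include he

/-- The curve `b r = bubble (r • e)` satisfies `b' = -(L b + r σ b) / (1 - r ^ 2)`; apply the skew
operator `L` to both sides and pair with `L b`. -/
lemma aBil_bubbleLie_deriv (hr : |r| < 1) :
    (1 - r ^ 2) * aBil hs (bubbleLie n s e r) (deriv (bubbleLie n s e) r) =
      -(r * (s - n / 2)) * aBil hs (bubbleLie n s e r) (bubbleLie n s e r) := by
  have hderiv := (hasDerivAt_bubble_smul hs.pos.le he hr).prodMk
    (differentiableAt_bubbleLie hs.pos.le he hr).hasDerivAt
  have hvel := mem_of_hasDerivAt (isClosed_lieGraph s e) hderiv <|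
    (continuous_abs.continuousAt.eventually_lt_const hr).mono fun t ht =>
      bubble_mem_lieGraph hs.pos.le he ht
  have hpair := aBil_self_of_mem_lieGraph hs <| sub_mem
    (neg_mem ((lieGraph s e).smul_mem (1 - r ^ 2) hvel))
    ((lieGraph s e).smul_mem (r * (s - n / 2)) (bubble_mem_lieGraph hs.pos.le he hr))
  change aBil hs (bubbleLie n s e r) (-((1 - r ^ 2) • deriv (bubbleLie n s e) r) -
    (r * (s - n / 2)) • bubbleLie n s e r) = 0 at hpair
  simp only [map_sub, map_neg, map_smul, smul_eq_mul] at hpair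
  linarith

lemma hasDerivAt_aBil_bubbleLie_sq (hr : |r| < 1) :
    HasDerivAt (fun t => aBil hs (bubbleLie n s e t) (bubbleLie n s e t) ^ 2)
      (-(4 * r * (s - n / 2) / (1 - r ^ 2)) *
        aBil hs (bubbleLie n s e r) (bubbleLie n s e r) ^ 2) r := by
  have hLie := (differentiableAt_bubbleLie hs.pos.le he hr).hasDerivAt
  refine ((((aBil hs).hasFDerivAt.comp_hasDerivAt r hLie).clm_apply hLie).fun_pow 2).congr_deriv ?_
  have hr2 : 1 - r ^ 2 ≠ 0 := (sub_pos.mpr ((sq_lt_one_iff_abs_lt_one r).mpr hr)).ne'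
  rw [Function.comp_apply, aBil_comm hs (deriv (bubbleLie n s e) r), neg_mul, div_mul_eq_mul_div,
    ← neg_div, eq_div_iff hr2]
  push_cast
  linear_combination
    4 * aBil hs (bubbleLie n s e r) (bubbleLie n s e r) * aBil_bubbleLie_deriv hs he hr

lemma abs_aBil_bubbleLie_le (hr₀ : 0 ≤ r) (hr : r < 1) :
    |aBil hs (bubbleLie n s e r) (bubbleLie n s e r)| ≤
      |aBil hs (bubbleLie n s e 0) (bubbleLie n s e 0)| := by
  have hderiv : ∀ t ∈ Set.Ico (0 : ℝ) 1, _ := fun t ht =>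
    hasDerivAt_aBil_bubbleLie_sq hs he (r := t) ((abs_of_nonneg ht.1).trans_lt ht.2)
  have hanti : AntitoneOn (fun t => aBil hs (bubbleLie n s e t) (bubbleLie n s e t) ^ 2)
      (Set.Ico 0 1) := by
    refine antitoneOn_of_deriv_nonpos (convex_Ico 0 1)
      (fun t ht => (hderiv t ht).continuousAt.continuousWithinAt)
      (fun t ht => (hderiv t (interior_subset ht)).differentiableAt.differentiableWithinAt)
      fun t ht => ?_
    obtain ⟨ht₀, ht₁⟩ := interior_subset ht
    rw [(hderiv t ⟨ht₀, ht₁⟩).deriv, neg_mul, neg_nonpos]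
    have hσ := hs.order_pos
    have ht2 : 0 < 1 - t ^ 2 := by nlinarith
    positivity
  exact sq_le_sq.mp (hanti ⟨le_rfl, zero_lt_one⟩ ⟨hr₀, hr⟩ hr₀)

omit he in
lemma exists_abs_aBil_bubbleLie_le : ∃ C : ℝ, ∀ e : Amb n, ‖e‖ = 1 → ∀ r : ℝ, 0 ≤ r →
    r < 1 → |aBil hs (bubbleLie n s e r) (bubbleLie n s e r)| ≤ C := by
  set T := fderiv ℝ (bubble n s) 0
  refine ⟨‖aBil hs‖ * ‖T‖ * ‖T‖, fun e he r hr₀ hr => ?_⟩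
  have hzero : ‖bubbleLie n s e 0‖ ≤ ‖T‖ := by
    simpa [bubbleLie_eq, he] using T.le_opNorm e
  refine (abs_aBil_bubbleLie_le hs he hr₀ hr).trans (((aBil hs).le_opNorm₂ _ _).trans ?_)
  gcongr

omit he in
lemma exists_norm_bubbleLie_le : ∃ C : ℝ, ∀ e : Amb n, ‖e‖ = 1 → ∀ r : ℝ, 0 ≤ r → r < 1 →
    ‖bubbleLie n s e r‖ ≤ C := by
  obtain ⟨C, D, hC, hD, hgarding⟩ := exists_garding_inequality hs
  obtain ⟨T, hT⟩ := exists_norm_toL2_bubbleLie_le hs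
  obtain ⟨A, hA⟩ := exists_abs_aBil_bubbleLie_le hs
  refine ⟨√(C * A + D * T ^ 2), fun e he r hr₀ hr => Real.le_sqrt_of_sq_le ?_⟩
  have hnorm : ‖(bubbleLie n s e r).toL2‖ ^ 2 ≤ T ^ 2 := by
    gcongr
    exact hT e he r (by rwa [abs_of_nonneg hr₀])
  have hform := (le_abs_self _).trans (hA e he r hr₀ hr)
  calc ‖bubbleLie n s e r‖ ^ 2 ≤ _ := hgarding _
    _ ≤ C * A + D * T ^ 2 := by gcongr

end UniformBound

/-! ### First moments of the optimizers -/

section Moment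

variable {n : ℕ}

instance (n : ℕ) : (surf n).IsOpenPosMeasure := by unfold surf; infer_instance

/-- The first moment of `(1 - ζ · ω) ^ σ` in direction `ζ`. -/
def moment (n : ℕ) (σ : ℝ) (ζ : Amb n) : ℝ :=
  ∫ ω : Sph n, inner ℝ ζ (ω : Amb n) * (1 - inner ℝ ζ (ω : Amb n)) ^ σ ∂(surf n)

lemma integral_inner_sphere (ζ : Amb n) : ∫ ω : Sph n, inner ℝ ζ (ω : Amb n) ∂(surf n) = 0 := by
  simpa [← polyCont_apply, polyCont_linForm] using integral_mul_harmonicPoly_eq_zero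
    one_ne_zero (linForm_mem_harmonicPoly ζ) (C_mem_harmonicPoly 1)

lemma mul_one_sub_rpow_le {σ t : ℝ} (hσ : 0 ≤ σ) (ht : t ≤ 1) : t * (1 - t) ^ σ ≤ t := by
  rcases le_total 0 t with ht₀ | ht₀
  · exact mul_le_of_le_one_right ht₀ (Real.rpow_le_one (by linarith) (by linarith) hσ)
  · nlinarith [Real.one_le_rpow (show 1 ≤ 1 - t by linarith) hσ]

variable {σ : ℝ} (hσ : 0 < σ)

include hσ

lemma continuous_inner_mul_rpow : Continuous fun p : Amb n × Sph n =>
    inner ℝ p.1 (p.2 : Amb n) * (1 - inner ℝ p.1 (p.2 : Amb n)) ^ σ :=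
  Continuous.mul (by fun_prop) (Continuous.rpow_const (by fun_prop) fun _ => Or.inr hσ.le)

lemma continuous_moment : Continuous (moment n σ) := by
  unfold moment
  simpa using continuous_parametric_integral_of_continuous (μ := surf n)
    (f := fun (ζ : Amb n) (ω : Sph n) => inner ℝ ζ (ω : Amb n) * (1 - inner ℝ ζ (ω : Amb n)) ^ σ)
    (continuous_inner_mul_rpow hσ) isCompact_univ

lemma moment_neg {ζ : Amb n} (hζ₀ : ζ ≠ 0) (hζ₁ : ‖ζ‖ ≤ 1) : moment n σ ζ < 0 := by
  have hlin : Continuous fun ω : Sph n => inner ℝ ζ (ω : Amb n) := by fun_prop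
  have hprod : Continuous fun ω : Sph n =>
      inner ℝ ζ (ω : Amb n) * (1 - inner ℝ ζ (ω : Amb n)) ^ σ :=
    (continuous_inner_mul_rpow hσ).comp (Continuous.prodMk_right ζ)
  have hint {f : Sph n → ℝ} (hf : Continuous f) : Integrable f (surf n) :=
    hf.integrable_of_hasCompactSupport (.of_compactSpace f)
  have hnorm : 0 < ‖ζ‖ := norm_pos_iff.mpr hζ₀
  have hpos : 0 < ∫ ω : Sph n, (inner ℝ ζ (ω : Amb n) -
      inner ℝ ζ (ω : Amb n) * (1 - inner ℝ ζ (ω : Amb n)) ^ σ) ∂(surf n) := by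
    refine integral_pos_of_integrable_nonneg_nonzero
      (x := ⟨‖ζ‖⁻¹ • ζ, by simp [norm_smul, hnorm.ne']⟩) (hlin.sub hprod) (hint (hlin.sub hprod))
      (fun ω => sub_nonneg.mpr (mul_one_sub_rpow_le hσ.le
        ((le_abs_self _).trans ((abs_inner_le_norm ζ ω).trans hζ₁)))) ?_
    have hinner : inner ℝ ζ (‖ζ‖⁻¹ • ζ) = ‖ζ‖ := by
      rw [real_inner_smul_right, real_inner_self_eq_norm_sq]
      field_simp
    simp only [hinner]
    nlinarith [Real.rpow_lt_one (show 0 ≤ 1 - ‖ζ‖ by linarith) (by linarith) hσ]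
  rw [integral_sub (hint hlin) (hint hprod), integral_inner_sphere, zero_sub] at hpos
  exact neg_pos.mp hpos

lemma exists_le_neg_moment {δ : ℝ} (hδ : 0 < δ) :
    ∃ c > 0, ∀ ζ : Amb n, δ ≤ ‖ζ‖ → ‖ζ‖ ≤ 1 → c ≤ -moment n σ ζ := by
  have hK : IsCompact {ζ : Amb n | δ ≤ ‖ζ‖ ∧ ‖ζ‖ ≤ 1} := by
    refine Metric.isCompact_of_isClosed_isBounded ?_ ?_
    · exact (isClosed_le continuous_const continuous_norm).inter
        (isClosed_le continuous_norm continuous_const)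
    · exact Metric.isBounded_closedBall.subset fun ζ hζ => mem_closedBall_zero_iff.mpr hζ.2
  obtain ⟨c, hc, hle⟩ := hK.exists_forall_le' (continuous_moment hσ).neg.continuousOn (a := 0)
    fun ζ hζ => neg_pos.mpr (moment_neg hσ (norm_pos_iff.mp (hδ.trans_le hζ.1)) hζ.2)
  exact ⟨c, hc, fun ζ h₁ h₂ => hle ζ ⟨h₁, h₂⟩⟩

omit hσ

lemma inner_bubble_linForm {s : ℝ} (hs : 0 ≤ s) {ζ : Amb n} (hζ : ‖ζ‖ < 1) :
    inner ℝ (bubble n s ζ).toL2 (restrictPoly n (linForm n ζ)) = moment n (s - n / 2) ζ := by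
  rw [toL2_bubble hs hζ, restrictPoly_apply, inner_toLp]
  exact integral_congr_ae <| .of_forall fun ω => by
    simp only [polyCont_linForm, binomImage_polyCont_apply _ hζ, mul_comm]

end Moment

/-! ### The manifold of optimizers -/

section Manifold

variable {n : ℕ} {s : ℝ}

/-- The constant function `1` in `H^s`. -/
def oneSob (n : ℕ) (s : ℝ) : Sob n s := polySob n s 1

/-- The parametrization `(c, ζ) ↦ c (1 - ζ · ω) ^ (s - n / 2)` of the optimizers. -/
def param (n : ℕ) (s : ℝ) (p : ℝ × Amb n) : Sob n s := p.1 • bubble n s p.2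

/-- The set of parameters `(c, ζ)` with `c > 0` and `|ζ| < 1`. -/
def paramDomain (n : ℕ) : Set (ℝ × Amb n) := Set.Ioi 0 ×ˢ Metric.ball 0 1

lemma mem_paramDomain {p : ℝ × Amb n} : p ∈ paramDomain n ↔ 0 < p.1 ∧ ‖p.2‖ < 1 := by
  simp [paramDomain]

lemma isOpen_paramDomain : IsOpen (paramDomain n) := isOpen_Ioi.prod Metric.isOpen_ball

lemma one_zero_mem_paramDomain : ((1, 0) : ℝ × Amb n) ∈ paramDomain n := by
  simp [mem_paramDomain]

lemma one_mem_harmonicPoly : (1 : Poly n) ∈ harmonicPoly n 0 := by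
  simpa using C_mem_harmonicPoly (n := n) 1

lemma oneSob_ae_eq : ∀ᵐ ω ∂(surf n), (oneSob n s).toL2 ω = 1 := by
  have h := ContinuousMap.coeFn_toLp (p := 2) (𝕜 := ℝ) (surf n) (polyCont n 1)
  rw [← restrictPoly_apply, ← toL2_polySob (s := s)] at h
  filter_upwards [h] with ω hω
  rw [oneSob, hω, map_one, ContinuousMap.one_apply]

variable (hs : 0 ≤ s) {p : ℝ × Amb n}

include hs

lemma bubble_zero : bubble n s 0 = oneSob n s := by
  refine ((hasPolyGrowth_polySob hs).hasSum_binomImage _ (by simp)).unique ?_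
  convert hasSum_single 0 fun k hk => ?_ using 1
  · simp [binCoeff_zero, oneSob]
  · simp [hk]

lemma param_one_zero : param n s (1, 0) = oneSob n s := by
  rw [param, bubble_zero hs, one_smul]

lemma toL2_param_ae_eq (hp : ‖p.2‖ < 1) : ∀ᵐ ω ∂(surf n),
    (param n s p).toL2 ω = p.1 * (1 - inner ℝ p.2 (ω : Amb n)) ^ ((2 * s - n) / 2) := by
  have hL2 : (param n s p).toL2 = ContinuousMap.toLp 2 (surf n) ℝ
      (p.1 • binomImage (polyCont n).toLinearMap (s - n / 2) p.2) := by
    rw [param, map_smul, toL2_bubble hs hp, map_smul]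
  rw [hL2]
  filter_upwards [ContinuousMap.coeFn_toLp (p := 2) (𝕜 := ℝ) (surf n)
    (p.1 • binomImage (polyCont n).toLinearMap (s - n / 2) p.2)] with ω hω
  rw [hω, ContinuousMap.smul_apply, binomImage_polyCont_apply _ hp, smul_eq_mul, sub_div,
    mul_div_cancel_left₀ s two_ne_zero]

lemma optimizers_eq_image : optimizers n s = param n s '' paramDomain n := by
  refine Set.Subset.antisymm ?_ ?_
  · rintro h ⟨c, hc, ζ, hζ, hh⟩
    refine ⟨(c, ζ), mem_paramDomain.mpr ⟨hc, hζ⟩, Sob.toL2_injective (Lp.ext ?_)⟩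
    filter_upwards [hh, toL2_param_ae_eq hs (p := (c, ζ)) hζ] with ω h₁ h₂
    rw [h₁, h₂]
  · rintro _ ⟨p, hp, rfl⟩
    obtain ⟨hc, hζ⟩ := mem_paramDomain.mp hp
    exact ⟨p.1, hc, p.2, hζ, toL2_param_ae_eq hs hζ⟩

lemma analyticAt_param (hp : p ∈ paramDomain n) : AnalyticAt ℝ (param n s) p :=
  analyticAt_fst.smul <| (analyticAt_bubble hs (mem_paramDomain.mp hp).2).comp analyticAt_snd

lemma fderiv_param (hp : p ∈ paramDomain n) (q : ℝ × Amb n) :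
    fderiv ℝ (param n s) p q = q.1 • bubble n s p.2 + p.1 • fderiv ℝ (bubble n s) p.2 q.2 := by
  have hbubble : HasFDerivAt (fun p : ℝ × Amb n => bubble n s p.2)
      ((fderiv ℝ (bubble n s) p.2).comp (ContinuousLinearMap.snd ℝ ℝ (Amb n))) p :=
    (analyticAt_bubble hs (mem_paramDomain.mp hp).2).differentiableAt.hasFDerivAt.comp p
      hasFDerivAt_snd
  have hparam : HasFDerivAt (param n s) _ p := (hasFDerivAt_fst (𝕜 := ℝ) (p := p)).smul hbubble
  rw [hparam.fderiv]
  simp [add_comm]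

lemma fderiv_param_mem_tangent (hp : p ∈ paramDomain n) (q : ℝ × Amb n) :
    fderiv ℝ (param n s) p q ∈ tangent (param n s p) := by
  have hline : HasDerivAt (fun t : ℝ => p + t • q) q 0 := by
    simpa using ((hasDerivAt_id (0 : ℝ)).smul_const q).const_add p
  refine ⟨fun t => param n s (p + t • q), ?_, by simp, ?_⟩
  · filter_upwards [hline.continuousAt.eventually_mem
      (isOpen_paramDomain.mem_nhds (by simpa using hp))] with t ht
    rw [optimizers_eq_image hs]
    exact Set.mem_image_of_mem _ ht
  · have hparam : HasFDerivAt (param n s) (fderiv ℝ (param n s) p) (p + (0 : ℝ) • q) := by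
      simpa using (analyticAt_param hs hp).differentiableAt.hasFDerivAt
    exact hparam.comp_hasDerivAt 0 hline

end Manifold

/-! ### Orthogonal decompositions of functions near `1` -/

section Far

variable {n : ℕ} {s : ℝ}

/-- `u = h + ρ` with `h` the optimizer of parameter `p` and `ρ` orthogonal to the tangent space
at `h`. -/
def IsOrthDecomp (u : Sob n s) (p : ℝ × Amb n) : Prop :=
  p ∈ paramDomain n ∧ u - param n s p ∈ tangentPerp (param n s p)

lemma tendsto_zero_of_neg_moment_le {ι : Type*} {l : Filter ι} {σ : ℝ} (hσ : 0 < σ)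
    {f : ι → Amb n} {g : ι → ℝ} (hg : Tendsto g l (𝓝 0))
    (hf : ∀ᶠ i in l, ‖f i‖ ≤ 1 ∧ -moment n σ (f i) ≤ g i) : Tendsto f l (𝓝 0) := by
  rw [tendsto_zero_iff_norm_tendsto_zero, Metric.tendsto_nhds]
  intro δ hδ
  obtain ⟨c, hc, hle⟩ := exists_le_neg_moment (n := n) hσ hδ
  filter_upwards [hf, hg.eventually_lt_const hc] with i hi hgi
  rw [dist_zero_right, norm_norm]
  by_contra! hδi
  exact (hle (f i) hδi hi.1).not_gt (hi.2.trans_lt hgi)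

lemma restrictPoly_ne_zero {q : Poly n} {ω : Sph n} (hω : polyCont n q ω ≠ 0) :
    restrictPoly n q ≠ 0 := by
  rw [restrictPoly_apply, ← map_zero (ContinuousMap.toLp 2 (surf n) ℝ),
    (ContinuousMap.toLp_injective (surf n)).ne_iff]
  exact fun h => hω (DFunLike.congr_fun h ω)

lemma restrictPoly_one_ne_zero : restrictPoly n 1 ≠ 0 := by
  obtain ⟨ω, hω⟩ := NormedSpace.sphere_nonempty (x := (0 : Amb n)).mpr zero_le_one
  exact restrictPoly_ne_zero (ω := ⟨ω, hω⟩) (by simp)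

lemma restrictPoly_linForm_ne_zero {ζ : Amb n} (hζ : ζ ≠ 0) : restrictPoly n (linForm n ζ) ≠ 0 := by
  have hunit : ‖‖ζ‖⁻¹ • ζ‖ = 1 := norm_smul_inv_norm hζ
  refine restrictPoly_ne_zero (ω := ⟨‖ζ‖⁻¹ • ζ, mem_sphere_zero_iff_norm.mpr hunit⟩) ?_
  rw [polyCont_linForm]
  simp [real_inner_smul_right, hζ]

lemma exists_unit_norm_smul_eq {E : Type*} [NormedAddCommGroup E] [NormedSpace ℝ E] [Nontrivial E]
    (x : E) : ∃ e : E, ‖e‖ = 1 ∧ ‖x‖ • e = x := by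
  rcases eq_or_ne x 0 with rfl | hx
  · obtain ⟨e, he⟩ := exists_norm_eq E zero_le_one
    exact ⟨e, he, by simp⟩
  · exact ⟨‖x‖⁻¹ • x, norm_smul_inv_norm hx, smul_inv_smul₀ (norm_ne_zero_iff.mpr hx) x⟩

variable (hs : IsAdmissible n s)

lemma aBil_oneSob_ne_zero : aBil hs (oneSob n s) (oneSob n s) ≠ 0 := by
  rw [oneSob, aBil_polySob hs _ one_mem_harmonicPoly]
  exact mul_ne_zero (hs.alpha_ne_zero 0) (inner_self_ne_zero.mpr restrictPoly_one_ne_zero)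

lemma aBil_oneSob_bubbleLie {e : Amb n} (he : ‖e‖ = 1) {r : ℝ} (hr : |r| < 1) :
    aBil hs (oneSob n s) (bubbleLie n s e r) = -((s - n / 2) * alpha n s 1 *
      inner ℝ (bubble n s (r • e)).toL2 (restrictPoly n (linForm n e))) := by
  have hskew := aBil_of_mem_lieGraph hs (polySob_mem_lieGraph s e 1)
    (bubble_mem_lieGraph hs.pos.le he hr)
  have hlie : lieOp e (s - n / 2) 1 = (s - n / 2) • linForm n e := by
    simpa using lieOp_linForm_pow he (s - n / 2) 0
  simp only [hlie, map_smul, FunLike.coe_smul, Pi.smul_apply, smul_eq_mul] at hskew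
  rw [aBil_comm hs (polySob n s (linForm n e)), aBil_polySob hs _ (linForm_mem_harmonicPoly e)]
    at hskew
  rw [aBil_comm, oneSob]
  linarith

lemma aBil_sub_param (u φ : Sob n s) (p : ℝ × Amb n) :
    aBil hs (u - param n s p) φ = aBil hs u φ - p.1 * aBil hs (bubble n s p.2) φ := by
  rw [param, map_sub, map_smul]
  rfl

namespace IsOrthDecomp

variable {u : Sob n s} {p : ℝ × Amb n} (h : IsOrthDecomp u p)

include h

lemma aBil_fderiv_param (q : ℝ × Amb n) :
    aBil hs (u - param n s p) (fderiv ℝ (param n s) p q) = 0 :=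
  h.2 _ (fderiv_param_mem_tangent hs.pos.le h.1 q)

lemma aBil_bubble : aBil hs (u - param n s p) (bubble n s p.2) = 0 := by
  simpa [fderiv_param hs.pos.le h.1] using h.aBil_fderiv_param hs (1, 0)

lemma aBil_fderiv_bubble (e : Amb n) :
    aBil hs (u - param n s p) (fderiv ℝ (bubble n s) p.2 e) = 0 := by
  simpa [fderiv_param hs.pos.le h.1, (mem_paramDomain.mp h.1).1.ne'] using
    h.aBil_fderiv_param hs (0, e)

/-- `bubbleLie` is tangent to the manifold, hence orthogonal to `u - h`, and by skewness it is
orthogonal to `h`. -/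
lemma aBil_bubbleLie {e : Amb n} (he : ‖e‖ = 1) {r : ℝ} (hr : |r| < 1) (hre : r • e = p.2) :
    aBil hs u (bubbleLie n s e r) = 0 := by
  have hperp : aBil hs (u - param n s p) (bubbleLie n s e r) = 0 := by
    rw [bubbleLie_eq, hre, map_sub (aBil hs (u - param n s p)), map_neg, map_smul, map_smul,
      h.aBil_fderiv_bubble, h.aBil_bubble, smul_zero, smul_zero, neg_zero, sub_zero]
  have hself := aBil_self_of_mem_lieGraph hs (bubble_mem_lieGraph hs.pos.le he hr)
  rw [hre] at hself
  rwa [aBil_sub_param, hself, mul_zero, sub_zero] at hperp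

end IsOrthDecomp

include hs

lemma exists_abs_inner_bubble_le : ∃ K : ℝ, ∀ (u : Sob n s) (p : ℝ × Amb n),
    IsOrthDecomp u p → ∀ (e : Amb n) (r : ℝ), ‖e‖ = 1 → 0 ≤ r → r < 1 → r • e = p.2 →
      |inner ℝ (bubble n s p.2).toL2 (restrictPoly n (linForm n e))| ≤ K * ‖u - oneSob n s‖ := by
  obtain ⟨C, hbound⟩ := exists_norm_bubbleLie_le hs
  have hσ := hs.order_pos
  have hα : 0 < |alpha n s 1| := abs_pos.mpr (hs.alpha_ne_zero 1)
  refine ⟨‖aBil hs‖ * C / ((s - n / 2) * |alpha n s 1|), fun u p h e r he hr₀ hr hre => ?_⟩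
  have hr' : |r| < 1 := by rwa [abs_of_nonneg hr₀]
  have hone : aBil hs (oneSob n s) (bubbleLie n s e r) =
      -aBil hs (u - oneSob n s) (bubbleLie n s e r) := by
    simp [h.aBil_bubbleLie hs he hr' hre]
  have habs : |aBil hs (oneSob n s) (bubbleLie n s e r)| ≤
      ‖aBil hs‖ * ‖u - oneSob n s‖ * C := by
    rw [hone, abs_neg]
    refine ((aBil hs).le_opNorm₂ _ _).trans ?_
    gcongr
    exact hbound e he r hr₀ hr
  rw [aBil_oneSob_bubbleLie hs he hr', hre, abs_neg, abs_mul, abs_mul, abs_of_pos hσ] at habs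
  rw [div_mul_eq_mul_div, le_div_iff₀ (by positivity)]
  linarith

lemma exists_neg_moment_le : ∃ K : ℝ, ∀ (u : Sob n s) (p : ℝ × Amb n), IsOrthDecomp u p →
    -moment n (s - n / 2) p.2 ≤ K * ‖u - oneSob n s‖ := by
  obtain ⟨K, hbound⟩ := exists_abs_inner_bubble_le hs
  refine ⟨K, fun u p h => ?_⟩
  have hp := (mem_paramDomain.mp h.1).2
  obtain ⟨e, he, hpe⟩ := exists_unit_norm_smul_eq p.2
  have hmoment : moment n (s - n / 2) p.2 =
      ‖p.2‖ * inner ℝ (bubble n s p.2).toL2 (restrictPoly n (linForm n e)) := by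
    rw [← inner_bubble_linForm hs.pos.le hp, ← real_inner_smul_right, ← map_smul, ← map_smul, hpe]
  calc -moment n (s - n / 2) p.2 ≤ |moment n (s - n / 2) p.2| := neg_le_abs _
    _ ≤ |inner ℝ (bubble n s p.2).toL2 (restrictPoly n (linForm n e))| := by
      rw [hmoment, abs_mul, abs_norm]
      exact mul_le_of_le_one_left (abs_nonneg _) hp.le
    _ ≤ _ := hbound u p h e _ he (norm_nonneg _) hp hpe

section Tendsto

variable {ι : Type*} {l : Filter ι} {u : ι → Sob n s} {p : ι → ℝ × Amb n}

lemma tendsto_aBil {v : ι → Sob n s} {u₀ v₀ : Sob n s} (hu : Tendsto u l (𝓝 u₀))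
    (hv : Tendsto v l (𝓝 v₀)) :
    Tendsto (fun i => aBil hs (u i) (v i)) l (𝓝 (aBil hs u₀ v₀)) := by
  generalize aBil hs = A
  exact (A.continuous₂.tendsto (u₀, v₀)).comp (hu.prodMk_nhds hv)

variable (hu : Tendsto u l (𝓝 (oneSob n s))) (hp : ∀ᶠ i in l, IsOrthDecomp (u i) (p i))

include hu hp

lemma tendsto_snd_of_isOrthDecomp : Tendsto (fun i => (p i).2) l (𝓝 0) := by
  obtain ⟨K, hK⟩ := exists_neg_moment_le hs
  refine tendsto_zero_of_neg_moment_le hs.order_pos (g := fun i => K * ‖u i - oneSob n s‖) ?_ ?_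
  · simpa using (hu.sub_const (oneSob n s)).norm.const_mul K
  · filter_upwards [hp] with i hi
    exact ⟨(mem_paramDomain.mp hi.1).2.le, hK _ _ hi⟩

/-- The scale `c` is recovered from `ζ` by orthogonality of `u - h` to the bubble at `ζ`. -/
lemma tendsto_of_isOrthDecomp : Tendsto p l (𝓝 (1, 0)) := by
  have hζ := tendsto_snd_of_isOrthDecomp hs hu hp
  have hbubble : Tendsto (fun i => bubble n s (p i).2) l (𝓝 (oneSob n s)) := by
    rw [← bubble_zero hs.pos.le]
    exact (analyticAt_bubble hs.pos.le (by simp)).continuousAt.tendsto.comp hζ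
  have hne := aBil_oneSob_ne_zero hs
  have hden := tendsto_aBil hs hbubble hbubble
  have hquot := (tendsto_aBil hs hu hbubble).div hden hne
  rw [div_self hne] at hquot
  refine Tendsto.prodMk_nhds (hquot.congr' ?_) hζ
  filter_upwards [hp, hden.eventually_ne hne] with i hi hi₀
  have horth := hi.aBil_bubble hs
  rw [aBil_sub_param] at horth
  rw [Pi.div_apply, div_eq_iff hi₀]
  linarith

end Tendsto

lemma eventually_isOrthDecomp_imp_mem {N : Set (ℝ × Amb n)}
    (hN : N ∈ 𝓝 ((1, 0) : ℝ × Amb n)) :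
    ∀ᶠ u in 𝓝 (oneSob n s), ∀ p : ℝ × Amb n, IsOrthDecomp u p → p ∈ N := by
  let l : Filter (Sob n s × ℝ × Amb n) :=
    comap Prod.fst (𝓝 (oneSob n s)) ⊓ 𝓟 {x | IsOrthDecomp x.1 x.2}
  have hfst : Tendsto Prod.fst l (𝓝 (oneSob n s)) := tendsto_comap.mono_left inf_le_left
  have hsnd := (tendsto_of_isOrthDecomp hs hfst
    (mem_inf_of_right (mem_principal_self _))).eventually_mem hN
  rw [eventually_inf_principal, eventually_comap] at hsnd
  filter_upwards [hsnd] with u hu p hp using hu (u, p) rfl hp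

end Far

/-! ### Submanifolds of a space with a bilinear form -/

section Parametrized

variable {X P : Type*} [NormedAddCommGroup X] [NormedSpace ℝ X]
  [NormedAddCommGroup P] [NormedSpace ℝ P] {Ψ : P → X} {p₀ : P}

lemma fderiv_apply_fderiv_eq_of_hasDerivAt {G : X → P} {p : P} {γ : ℝ → X} {η : X} {t₀ : ℝ}
    (hΨ : DifferentiableAt ℝ Ψ p) (hG : DifferentiableAt ℝ G (Ψ p)) (hGp : G (Ψ p) = p)
    (hγ : ∀ᶠ t in 𝓝 t₀, Ψ (G (γ t)) = γ t) (hγ₀ : γ t₀ = Ψ p) (hη : HasDerivAt γ η t₀) :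
    fderiv ℝ Ψ p (fderiv ℝ G (Ψ p) η) = η := by
  rw [← hγ₀] at hG hGp ⊢
  have hΨ' : HasFDerivAt Ψ (fderiv ℝ Ψ p) (G (γ t₀)) := by
    rw [hGp]
    exact hΨ.hasFDerivAt
  have hcomp := hΨ'.comp_hasDerivAt t₀ (hG.hasFDerivAt.comp_hasDerivAt t₀ hη)
  exact (hcomp.congr_of_eventuallyEq (hγ.mono fun t ht => ht.symm)).unique hη

lemma exists_eventually_leftInverse [CompleteSpace P] {Y : Type*} [NormedAddCommGroup Y]
    [NormedSpace ℝ Y] {L : X →L[ℝ] Y} (hΨ : ContDiffAt ℝ 1 Ψ p₀)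
    (hL : (L ∘L fderiv ℝ Ψ p₀).IsInvertible) :
    ∃ G : X → P, ∀ᶠ p in 𝓝 p₀, G (Ψ p) = p ∧ DifferentiableAt ℝ G (Ψ p) := by
  obtain ⟨B, hB⟩ := hL
  have hF : ContDiffAt ℝ 1 (fun p => L (Ψ p)) p₀ := L.contDiff.contDiffAt.comp p₀ hΨ
  have hF' : HasFDerivAt (fun p => L (Ψ p)) (B : P →L[ℝ] Y) p₀ := by
    rw [hB]
    exact L.hasFDerivAt.comp p₀ (hΨ.differentiableAt one_ne_zero).hasFDerivAt
  have hG : ContDiffAt ℝ 1 (hF.localInverse hF' one_ne_zero) (L (Ψ p₀)) :=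
    hF.to_localInverse hF' one_ne_zero
  refine ⟨fun x => hF.localInverse hF' one_ne_zero (L x), ?_⟩
  filter_upwards [(hF.hasStrictFDerivAt' hF' one_ne_zero).eventually_left_inverse,
    hF.continuousAt.eventually (hG.eventually (by simp))] with p hleft hdiff
  exact ⟨hleft, (hdiff.differentiableAt one_ne_zero).comp (Ψ p) L.differentiableAt⟩

lemma eventually_velocity_mem_range_fderiv [CompleteSpace P] {Y : Type*} [NormedAddCommGroup Y]
    [NormedSpace ℝ Y] {L : X →L[ℝ] Y} (hΨ : ContDiffAt ℝ 1 Ψ p₀)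
    (hL : (L ∘L fderiv ℝ Ψ p₀).IsInvertible) {S : Set P}
    (hS : ∀ N ∈ 𝓝 p₀, ∀ᶠ x in 𝓝 (Ψ p₀), ∀ p ∈ S, Ψ p = x → p ∈ N) :
    ∀ᶠ p in 𝓝 p₀, ∀ (γ : ℝ → X) (η : X), (∀ᶠ t in 𝓝 0, γ t ∈ Ψ '' S) → γ 0 = Ψ p →
      HasDerivAt γ η 0 → η ∈ Set.range (fderiv ℝ Ψ p) := by
  obtain ⟨G, hG⟩ := exists_eventually_leftInverse hΨ hL
  have hΨ' : ∀ᶠ p in 𝓝 p₀, ContDiffAt ℝ 1 Ψ p := hΨ.eventually (by simp)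
  filter_upwards [hG, hΨ', hΨ.continuousAt.eventually (hS _ hG).eventually_nhds]
    with p ⟨hGp, hGdiff⟩ hΨp hSp γ η hγ hγ₀ hη
  refine ⟨_, fderiv_apply_fderiv_eq_of_hasDerivAt (hΨp.differentiableAt one_ne_zero) hGdiff hGp
    ?_ hγ₀ hη⟩
  rw [← hγ₀] at hSp
  filter_upwards [hγ, hη.continuousAt.eventually hSp] with t ⟨q, hq, hqt⟩ ht
  have hGq : G (Ψ q) = q := (ht q hq hqt).1
  rw [← hqt, hGq]

/-- The pullback `x ↦ A x (D ·)` of a bilinear form in its second argument along a linear map. -/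
def pullback (A : X →L[ℝ] X →L[ℝ] ℝ) (D : P →L[ℝ] X) : X →L[ℝ] P →L[ℝ] ℝ :=
  ((ContinuousLinearMap.compL ℝ P X ℝ).flip D).comp A

lemma isInvertible_of_injective [FiniteDimensional ℝ P] {B : P →L[ℝ] P →L[ℝ] ℝ}
    (hB : Function.Injective B) : B.IsInvertible := by
  have hdim : Module.finrank ℝ P = Module.finrank ℝ (P →L[ℝ] ℝ) := by
    rw [← (LinearMap.toContinuousLinearMap (𝕜 := ℝ) (E := P) (F' := ℝ)).finrank_eq]
    exact (Subspace.dual_finrank_eq (K := ℝ) (V := P)).symm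
  exact ⟨(LinearMap.linearEquivOfInjective B.toLinearMap hB hdim).toContinuousLinearEquiv, rfl⟩

variable {A : X →L[ℝ] X →L[ℝ] ℝ}

lemma pullback_apply (D : P →L[ℝ] X) (x : X) (q : P) : pullback A D x q = A x (D q) := rfl

lemma exists_hasStrictFDerivAt_pullback_sub (hΨ : ContDiffAt ℝ 2 Ψ p₀) :
    ∃ f' : X × P →L[ℝ] P →L[ℝ] ℝ, HasStrictFDerivAt
        (fun v : X × P => pullback A (fderiv ℝ Ψ v.2) (v.1 - Ψ v.2)) f' (Ψ p₀, p₀) ∧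
      f' ∘L .inr ℝ X P = -(pullback A (fderiv ℝ Ψ p₀) ∘L fderiv ℝ Ψ p₀) := by
  have hΨ' : HasStrictFDerivAt (fun v : X × P => Ψ v.2)
      ((fderiv ℝ Ψ p₀).comp (ContinuousLinearMap.snd ℝ X P)) (Ψ p₀, p₀) :=
    (hΨ.hasStrictFDerivAt two_ne_zero).comp (Ψ p₀, p₀) hasStrictFDerivAt_snd
  have hfderiv : HasStrictFDerivAt (fderiv ℝ Ψ) (fderiv ℝ (fderiv ℝ Ψ) p₀) p₀ :=
    (hΨ.fderiv_right (m := 1) (by norm_num)).hasStrictFDerivAt one_ne_zero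
  have hA := A.hasStrictFDerivAt.comp (Ψ p₀, p₀) (hasStrictFDerivAt_fst.sub hΨ')
  refine ⟨_, hA.clm_comp (hfderiv.comp (Ψ p₀, p₀) hasStrictFDerivAt_snd), ?_⟩
  ext q q'
  simp [pullback_apply]

lemma exists_orthogonal_projection [CompleteSpace X] [FiniteDimensional ℝ P]
    (hΨ : ContDiffAt ℝ 2 Ψ p₀)
    (hA : Function.Injective (pullback A (fderiv ℝ Ψ p₀) ∘L fderiv ℝ Ψ p₀)) :
    ∃ ψ : X → P, Tendsto ψ (𝓝 (Ψ p₀)) (𝓝 p₀) ∧ ∀ᶠ v in 𝓝 (Ψ p₀, p₀),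
      pullback A (fderiv ℝ Ψ v.2) (v.1 - Ψ v.2) = 0 ↔ ψ v.1 = v.2 := by
  have : CompleteSpace P := FiniteDimensional.complete ℝ P
  obtain ⟨f', hf, hf'⟩ := exists_hasStrictFDerivAt_pullback_sub (A := A) hΨ
  have hinv : (f' ∘L .inr ℝ X P).IsInvertible := by
    refine isInvertible_of_injective ?_
    rw [hf', FunLike.coe_neg]
    exact neg_injective.comp hA
  refine ⟨hf.implicitFunctionOfProdDomain hinv,
    hf.tendsto_implicitFunctionOfProdDomain hinv, ?_⟩
  filter_upwards [hf.eventually_apply_eq_iff_implicitFunctionOfProdDomain hinv] with v hv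
  rw [← hv, sub_self, map_zero]

end Parametrized

/-! ### Nondegeneracy at the constant function -/

section Nondegenerate

variable {n : ℕ} {s : ℝ}

lemma inner_restrictPoly_one_linForm (ζ : Amb n) :
    inner ℝ (restrictPoly n 1) (restrictPoly n (linForm n ζ)) = 0 :=
  inner_eq_zero_of_mem_sphHarm zero_ne_one (restrictPoly_mem_sphHarm one_mem_harmonicPoly)
    (restrictPoly_mem_sphHarm (linForm_mem_harmonicPoly ζ))

lemma fderiv_bubble_zero (hs : 0 ≤ s) (ζ : Amb n) :
    fderiv ℝ (bubble n s) 0 ζ = -(s - n / 2) • polySob n s (linForm n ζ) := by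
  have hsum := (hasPolyGrowth_polySob (n := n) hs).hasSum_fderiv_binomImage (s - n / 2)
    (e := ζ) (r := 0) (by simp)
  rw [zero_smul] at hsum
  refine hsum.unique ?_
  convert hasSum_single 0 fun k hk => ?_ using 1
  · simp [binCoeff]
  · simp [hk]

lemma fderiv_param_one_zero (hs : 0 ≤ s) (q : ℝ × Amb n) :
    fderiv ℝ (param n s) (1, 0) q =
      q.1 • oneSob n s + (-(s - n / 2)) • polySob n s (linForm n q.2) := by
  rw [fderiv_param hs one_zero_mem_paramDomain, bubble_zero hs, fderiv_bubble_zero hs, one_smul]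

variable (hs : IsAdmissible n s)

lemma aBil_fderiv_param_one_zero (q q' : ℝ × Amb n) :
    aBil hs (fderiv ℝ (param n s) (1, 0) q) (fderiv ℝ (param n s) (1, 0) q') =
      alpha n s 0 * inner ℝ (restrictPoly n 1) (restrictPoly n 1) * (q.1 * q'.1) +
      alpha n s 1 * (s - n / 2) ^ 2 *
        inner ℝ (restrictPoly n (linForm n q.2)) (restrictPoly n (linForm n q'.2)) := by
  rw [fderiv_param_one_zero hs.pos.le q', map_add, map_smul, map_smul, oneSob,
    aBil_polySob hs _ one_mem_harmonicPoly, aBil_polySob hs _ (linForm_mem_harmonicPoly q'.2),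
    fderiv_param_one_zero hs.pos.le q, oneSob, map_add, map_smul, map_smul, toL2_polySob,
    toL2_polySob]
  simp only [inner_add_left, real_inner_smul_left, inner_restrictPoly_one_linForm,
    real_inner_comm (restrictPoly n 1) (restrictPoly n (linForm n q.2)), smul_eq_mul]
  ring

lemma injective_pullback_fderiv_param_one_zero : Function.Injective
    (pullback (aBil hs) (fderiv ℝ (param n s) (1, 0)) ∘L fderiv ℝ (param n s) (1, 0)) := by
  refine (injective_iff_map_eq_zero _).mpr fun q hq => ?_
  have hform (q' : ℝ × Amb n) := (aBil_fderiv_param_one_zero hs q q').symm.trans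
    (DFunLike.congr_fun hq q')
  have hfst : q.1 = 0 := by
    simpa [hs.alpha_ne_zero 0, restrictPoly_one_ne_zero] using hform (1, 0)
  have hsnd : q.2 = 0 := by
    by_contra hne
    simpa [hs.alpha_ne_zero 1, hs.order_pos.ne', restrictPoly_linForm_ne_zero hne] using
      hform (0, q.2)
  exact Prod.ext hfst hsnd

end Nondegenerate

/-! ### Local existence and uniqueness of orthogonal decompositions -/

section Decomposition

variable {n : ℕ} {s : ℝ}

lemma modDist_eq_of_unique {u h : Sob n s} (hh : h ∈ optimizers n s)
    (hperp : u - h ∈ tangentPerp h)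
    (hunique : ∀ h' ∈ optimizers n s, u - h' ∈ tangentPerp h' → h' = h) :
    modDist u = ((aQuad (u - h) : ℝ) : EReal) := by
  have hset : {x : EReal | ∃ h ∈ optimizers n s, ∃ ρ ∈ tangentPerp h,
      u = h + ρ ∧ x = ((aQuad ρ : ℝ) : EReal)} = {((aQuad (u - h) : ℝ) : EReal)} := by
    refine Set.eq_singleton_iff_unique_mem.mpr ⟨⟨h, hh, u - h, hperp, by abel, rfl⟩, ?_⟩
    rintro x ⟨h', hh', ρ, hρ, rfl, rfl⟩
    obtain rfl : h' = h := hunique h' hh' (by simpa using hρ)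
    simp
  rw [modDist, hset, sInf_singleton]

variable (hs : IsAdmissible n s)

include hs

lemma isOrthDecomp_param {p : ℝ × Amb n} (hp : p ∈ paramDomain n) :
    IsOrthDecomp (param n s p) p := by
  refine ⟨hp, fun φ _ => ?_⟩
  rw [← aBil_apply hs, sub_self, map_zero, zero_apply]

lemma eventually_tangent_subset_range : ∀ᶠ p in 𝓝 ((1, 0) : ℝ × Amb n),
    tangent (param n s p) ⊆ Set.range (fderiv ℝ (param n s) p) := by
  have hparam : ContDiffAt ℝ 1 (param n s) (1, 0) :=
    (analyticAt_param hs.pos.le one_zero_mem_paramDomain).contDiffAt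
  filter_upwards [eventually_velocity_mem_range_fderiv (S := paramDomain n) hparam
    (isInvertible_of_injective (injective_pullback_fderiv_param_one_zero hs)) fun N hN => by
      rw [param_one_zero hs.pos.le]
      filter_upwards [eventually_isOrthDecomp_imp_mem hs hN] with u hu p hp hpu
      exact hu p (hpu ▸ isOrthDecomp_param hs hp)]
    with p hp η ⟨γ, hγ, hγ₀, hη⟩
  rw [optimizers_eq_image hs.pos.le] at hγ
  exact hp γ η hγ hγ₀ hη

lemma eventually_isOrthDecomp_iff : ∀ᶠ p in 𝓝 ((1, 0) : ℝ × Amb n), ∀ u,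
    IsOrthDecomp u p ↔
      pullback (aBil hs) (fderiv ℝ (param n s) p) (u - param n s p) = 0 := by
  filter_upwards [eventually_tangent_subset_range hs,
    isOpen_paramDomain.mem_nhds one_zero_mem_paramDomain] with p htangent hp u
  refine ⟨fun h => ContinuousLinearMap.ext fun q => h.aBil_fderiv_param hs q,
    fun h => ⟨hp, fun φ hφ => ?_⟩⟩
  obtain ⟨q, rfl⟩ := htangent hφ
  rw [← aBil_apply hs]
  exact DFunLike.congr_fun h q

lemma exists_tendsto_isOrthDecomp_iff : ∃ ψ : Sob n s → ℝ × Amb n,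
    Tendsto ψ (𝓝 (oneSob n s)) (𝓝 (1, 0)) ∧
      ∀ᶠ u in 𝓝 (oneSob n s), ∀ p, IsOrthDecomp u p ↔ p = ψ u := by
  have hparam := analyticAt_param hs.pos.le (one_zero_mem_paramDomain (n := n))
  obtain ⟨ψ, hψ, hiff⟩ := exists_orthogonal_projection hparam.contDiffAt
    (injective_pullback_fderiv_param_one_zero hs)
  rw [param_one_zero hs.pos.le] at hψ hiff
  rw [nhds_prod_eq] at hiff
  obtain ⟨U, hU, N, hN, hiff⟩ := eventually_prod_iff.mp hiff
  have hlocal := hN.and (eventually_isOrthDecomp_iff hs)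
  refine ⟨ψ, hψ, ?_⟩
  filter_upwards [hU, hψ.eventually hlocal, eventually_isOrthDecomp_imp_mem hs hlocal]
    with u hu hψu hmem p
  refine ⟨fun h => ?_, ?_⟩
  · obtain ⟨hp, hperp⟩ := hmem p h
    exact ((hiff hu hp).mp ((hperp u).mp h)).symm
  · rintro rfl
    exact (hψu.2 u).mpr ((hiff hu hψu.1).mpr rfl)

end Decomposition

theorem mainTheorem5_general (n : ℕ) (s : ℝ) (hs : IsAdmissible n s) :
    ∃ one : Sob n s, (∀ᵐ ω ∂(surf n), one.toL2 ω = 1) ∧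
      ∀ V ∈ 𝓝 one, ∀ᶠ u in 𝓝 one,
        ∃ h ∈ V ∩ optimizers n s, u - h ∈ tangentPerp h ∧
          (∀ h' ∈ optimizers n s, u - h' ∈ tangentPerp h' → h' = h) ∧
          modDist u = ((aQuad (u - h) : ℝ) : EReal) := by
  refine ⟨oneSob n s, oneSob_ae_eq, fun V hV => ?_⟩
  obtain ⟨ψ, hψ, hiff⟩ := exists_tendsto_isOrthDecomp_iff hs
  have hparam := (analyticAt_param hs.pos.le (one_zero_mem_paramDomain (n := n))).continuousAt
  rw [← param_one_zero hs.pos.le] at hV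
  filter_upwards [hiff, hψ.eventually (hparam.eventually_mem hV)] with u hu hV
  obtain ⟨hmem, hperp⟩ := (hu (ψ u)).mpr rfl
  have hopt : param n s (ψ u) ∈ optimizers n s := by
    rw [optimizers_eq_image hs.pos.le]
    exact Set.mem_image_of_mem _ hmem
  have hunique : ∀ h' ∈ optimizers n s, u - h' ∈ tangentPerp h' → h' = param n s (ψ u) := by
    rw [optimizers_eq_image hs.pos.le]
    rintro _ ⟨p, hp, rfl⟩ hperp'
    rw [(hu p).mp ⟨hp, hperp'⟩]
  exact ⟨_, ⟨hV, hopt⟩, hperp, hunique, modDist_eq_of_unique hopt hperp hunique⟩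

lemma IsAdmissible.of_mem_Ioo_union {n : ℕ} {s : ℝ}
    (hs : s - (n : ℝ) / 2 ∈ Set.Ioo (0 : ℝ) 1 ∪ Set.Ioo (1 : ℝ) 2) : IsAdmissible n s where
  half_lt := by rcases hs with h | h <;> linarith [h.1]
  ne_nat m hm := by
    rw [hm] at hs
    rcases hs with ⟨hlo, hhi⟩ | ⟨hlo, hhi⟩ <;> norm_cast at hlo hhi <;> omega

end ReverseSobolev

end

open ReverseSobolev

theorem mainTheorem5 (n : ℕ) (hn : 1 ≤ n) (s : ℝ)
    (hs : s - (n : ℝ) / 2 ∈ Set.Ioo (0 : ℝ) 1 ∪ Set.Ioo (1 : ℝ) 2) :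
    ∃ one : Sob n s, (∀ᵐ ω ∂(surf n), one.toL2 ω = 1) ∧
      ∃ U ∈ 𝓝 one, ∃ V ∈ 𝓝 one, ∀ u ∈ U,
        ∃ h ∈ V ∩ optimizers n s, u - h ∈ tangentPerp h ∧
          (∀ h' ∈ V ∩ optimizers n s, u - h' ∈ tangentPerp h' → h' = h) ∧
          modDist u = ((aQuad (u - h) : ℝ) : EReal) := by
  obtain ⟨one, hone, hdecomp⟩ := mainTheorem5_general n s (.of_mem_Ioo_union hs)
  refine ⟨one, hone, _, hdecomp Set.univ univ_mem, Set.univ, univ_mem, fun u hu => ?_⟩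
  obtain ⟨h, hh, hperp, hunique, hdist⟩ := hu
  exact ⟨h, hh, hperp, fun h' hh' => hunique h' hh'.2, hdist⟩
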